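/- Let $D\ge 1$ and $N\ge 3$ be integers and let $\Gamma=H(D,N)$ be the Hamming graph: its vertex set $X$ consists of the $D$-tuples with entries in $\{1,\dots,N\}$, two tuples being adjacent when they differ in exactly one coordinate. Let $\partial$ be the path-length distance of $\Gamma$, let $\Gamma(x)$ be the set of neighbours of $x$, let $G=\mathrm{Aut}(\Gamma)$, and put $\theta^*_i=D(N-1)-iN$ for $0\le i\le D$. Let $V$ be the complex vector space with basis $X$, let $V^{\otimes 3}=V\otimes V\otimes V$ carry the Hermitian form for which the vectors $x\otimes y\otimes z$ $(x,y,z\in X)$ are orthonormal, and let ${\bf 1}=\sum_{x\in X}x$. Let $\mathbb T$ be the $S_3$-symmetric tridiagonal algebra with parameters $\beta=2$, $\gamma=\gamma^*=0$, $\varrho=\varrho^*=N^2$: the associative unital $\mathbb C$-algebra with generators $A_i,A^*_i$ $(i\in\{1,2,3\})$ and relations $[A_i,A_j]=0$, $[A^*_i,A^*_j]=0$, $[A_i,A^*_i]=0$ for all $i,j$ and, for $i\ne j$, $$[A_i,\,A_i^2A_j^*-\beta A_iA_j^*A_i+A_j^*A_i^2-\gamma(A_iA_j^*+A_j^*A_i)-\varrho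 A_j^*]=0,$$ $$[A_j^*,\,A_j^{*2}A_i-\beta A_j^*A_iA_j^*+A_iA_j^{*2}-\gamma^*(A_j^*A_i+A_iA_j^*)-\varrho^*A_i]=0.$$ The space $V^{\otimes 3}$ is a $\mathbb T$-module on which, for $x,y,z\in X$, $A_1(x\otimes y\otimes z)=\sum_{\xi\in\Gamma(x)}\xi\otimes y\otimes z$, $A_2(x\otimes y\otimes z)=\sum_{\xi\in\Gamma(y)}x\otimes\xi\otimes z$, $A_3(x\otimes y\otimes z)=\sum_{\xi\in\Gamma(z)}x\otimes y\otimes\xi$, and $A^*_1,A^*_2,A^*_3$ multiply $x\otimes y\otimes z$ by $\theta^*_{\partial(y,z)}$, $\theta^*_{\partial(z,x)}$, $\theta^*_{\partial(x,y)}$ respectively. The group $G$ acts linearly on $V^{\otimes 3}$ by $g(x\otimes y\otimes z)=g(x)\otimes g(y)\otimes g(z)$; let $\mathrm{Fix}(G)$ be the subspace of vectors fixed by every $g\in G$. There is a unique irreducible $\mathbb T$-submodule $\Lambda$ of $V^{\otimes 3}$ that contains ${\bf 1}\otimes{\bf 1}\otimes{\bf 1}$ (the fundamental $\mathbb T$-submodule),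 and the following hold. (i) $\Lambda=\mathrm{Fix}(G)$. (ii) Let $\mathcal P$ be the set of sequences $(d_1,\dots,d_5)$ of natural numbers (including $0$) with $d_1+\dots+d_5=D$. Sending $(x,y,z)\in X^3$ to $(d_1,\dots,d_5)$, where $d_1,\dots,d_5$ are the numbers of coordinates $i$ with, respectively, $x_i=y_i=z_i$; $x_i\ne y_i=z_i$; $y_i\ne z_i=x_i$; $z_i\ne x_i=y_i$; and $x_i,y_i,z_i$ mutually distinct, induces a bijection from the set of $G$-orbits on $X^3$ to $\mathcal P$. For $(d_1,\dots,d_5)\in\mathcal P$ let $\chi(d_1,\dots,d_5)$ be the sum of the $x\otimes y\otimes z$ with $(x,y,z)$ in the corresponding orbit. The vectors $\chi(d_1,\dots,d_5)$, $(d_1,\dots,d_5)\in\mathcal P$, form an orthogonal basis of $\Lambda$. (iii) $\dim\Lambda=\binom{D+4}{4}$. -/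

import Mathlib

open scoped TensorProduct

/-! ### The `S₃`-symmetric tridiagonal algebra -/

/-- The free generators: `Sum.inl i` stands for `A_i` and `Sum.inr i` for `A*_i`
(the index set `{1,2,3}` is `Fin 3`). -/
abbrev S3TridiagGen : Type := Fin 3 ⊕ Fin 3

/-- The free generator `A_i`. -/
abbrev freeA (F : Type*) [Field F] (i : Fin 3) : FreeAlgebra F S3TridiagGen :=
  FreeAlgebra.ι F (Sum.inl i)

/-- The free generator `A*_i`. -/
abbrev freeAs (F : Type*) [Field F] (i : Fin 3) : FreeAlgebra F S3TridiagGen :=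
  FreeAlgebra.ι F (Sum.inr i)

/-- The defining relations of the `S₃`-symmetric tridiagonal algebra; `⁅a, b⁆ = a * b - b * a`. -/
inductive S3TridiagRel {F : Type*} [Field F] (β γ γs ϱ ϱs : F) :
    FreeAlgebra F S3TridiagGen → FreeAlgebra F S3TridiagGen → Prop
  | comm_A (i j : Fin 3) : S3TridiagRel β γ γs ϱ ϱs ⁅freeA F i, freeA F j⁆ 0
  | comm_As (i j : Fin 3) : S3TridiagRel β γ γs ϱ ϱs ⁅freeAs F i, freeAs F j⁆ 0
  | comm_A_As (i : Fin 3) : S3TridiagRel β γ γs ϱ ϱs ⁅freeA F i, freeAs F i⁆ 0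
  | tridiag (i j : Fin 3) (hij : i ≠ j) : S3TridiagRel β γ γs ϱ ϱs
      ⁅freeA F i, freeA F i ^ 2 * freeAs F j - β • (freeA F i * freeAs F j * freeA F i)
        + freeAs F j * freeA F i ^ 2 - γ • (freeA F i * freeAs F j + freeAs F j * freeA F i)
        - ϱ • freeAs F j⁆ 0
  | tridiag_dual (i j : Fin 3) (hij : i ≠ j) : S3TridiagRel β γ γs ϱ ϱs
      ⁅freeAs F j, freeAs F j ^ 2 * freeA F i - β • (freeAs F j * freeA F i * freeAs F j)
        + freeA F i * freeAs F j ^ 2 - γs • (freeAs F j * freeA F i + freeA F i * freeAs F j)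
        - ϱs • freeA F i⁆ 0

/-- The `S₃`-symmetric tridiagonal algebra `𝕋(β, γ, γ*, ϱ, ϱ*)`. -/
abbrev S3TridiagAlgebra {F : Type*} [Field F] (β γ γs ϱ ϱs : F) : Type _ :=
  RingQuot (S3TridiagRel β γ γs ϱ ϱs)

/-! ### The standard module of a finite graph and its tensor cube -/

noncomputable section

/-- The standard module: the complex vector space with orthonormal basis `X`. -/
abbrev StdModule (X : Type) [Fintype X] : Type := EuclideanSpace ℂ X

/-- `V ⊗ V ⊗ V`, with the inner product of a tensor product of inner product spaces. -/
abbrev StdCube (X : Type) [Fintype X] : Type :=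
  StdModule X ⊗[ℂ] (StdModule X ⊗[ℂ] StdModule X)

/-- The vertex `x`, as a basis vector of the standard module. -/
def vtx {X : Type} [Fintype X] [DecidableEq X] (x : X) : StdModule X :=
  EuclideanSpace.single x (1 : ℂ)

/-- The vector `x ⊗ y ⊗ z` for a triple `t = (x, y, z)` of vertices. -/
def vtx3 {X : Type} [Fintype X] [DecidableEq X] (t : X × X × X) : StdCube X :=
  vtx t.1 ⊗ₜ[ℂ] (vtx t.2.1 ⊗ₜ[ℂ] vtx t.2.2)

/-- The basis of `V ⊗ V ⊗ V` formed by the vectors `x ⊗ y ⊗ z`. -/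
def cubeBasis (X : Type) [Fintype X] [DecidableEq X] :
    Module.Basis (X × X × X) ℂ (StdCube X) :=
  let b := (EuclideanSpace.basisFun X ℂ).toBasis
  b.tensorProduct (b.tensorProduct b)

theorem cubeBasis_apply {X : Type} [Fintype X] [DecidableEq X] (t : X × X × X) :
    cubeBasis X t = vtx3 t := by
  obtain ⟨x, y, z⟩ := t
  simp [cubeBasis, vtx3, vtx]

/-- The vector `𝟏 ⊗ 𝟏 ⊗ 𝟏`, where `𝟏` is the sum of all vertices. -/
def oneCube (X : Type) [Fintype X] [DecidableEq X] : StdCube X :=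
  (∑ x : X, vtx x) ⊗ₜ[ℂ] ((∑ x : X, vtx x) ⊗ₜ[ℂ] (∑ x : X, vtx x))

/-- The maps `A⁽¹⁾, A⁽²⁾, A⁽³⁾`: sum over the neighbours of the first, second, third vertex. -/
def nodeMap {X : Type} [Fintype X] [DecidableEq X] (Γ : SimpleGraph X) [DecidableRel Γ.Adj] :
    Fin 3 → Module.End ℂ (StdCube X)
  | 0 => (cubeBasis X).constr ℂ fun t => ∑ ξ ∈ Γ.neighborFinset t.1, vtx3 (ξ, t.2.1, t.2.2)
  | 1 => (cubeBasis X).constr ℂ fun t => ∑ ξ ∈ Γ.neighborFinset t.2.1, vtx3 (t.1, ξ, t.2.2)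
  | 2 => (cubeBasis X).constr ℂ fun t => ∑ ξ ∈ Γ.neighborFinset t.2.2, vtx3 (t.1, t.2.1, ξ)

/-- The maps `A*⁽¹⁾, A*⁽²⁾, A*⁽³⁾`, for the sequence `θs` of dual eigenvalues: `x ⊗ y ⊗ z` is
multiplied by `θs ∂(y,z)`, `θs ∂(z,x)`, `θs ∂(x,y)`, where `∂` is the path-length distance. -/
def edgeMap {X : Type} [Fintype X] [DecidableEq X] (Γ : SimpleGraph X) (θs : ℕ → ℂ) :
    Fin 3 → Module.End ℂ (StdCube X)
  | 0 => (cubeBasis X).constr ℂ fun t => θs (Γ.dist t.2.1 t.2.2) • vtx3 t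
  | 1 => (cubeBasis X).constr ℂ fun t => θs (Γ.dist t.2.2 t.1) • vtx3 t
  | 2 => (cubeBasis X).constr ℂ fun t => θs (Γ.dist t.1 t.2.1) • vtx3 t

/-- The action on the standard module of an automorphism `g` of `Γ`, sending `x` to `g x`. -/
def autMap {X : Type} [Fintype X] [DecidableEq X] {Γ : SimpleGraph X} (g : Γ ≃g Γ) :
    Module.End ℂ (StdModule X) :=
  (EuclideanSpace.basisFun X ℂ).toBasis.constr ℂ fun x => vtx (g x)

/-- The action on `V ⊗ V ⊗ V` of an automorphism `g`: `u ⊗ v ⊗ w ↦ g u ⊗ g v ⊗ g w`. -/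
def autMap3 {X : Type} [Fintype X] [DecidableEq X] {Γ : SimpleGraph X} (g : Γ ≃g Γ) :
    Module.End ℂ (StdCube X) :=
  TensorProduct.map (autMap g) (TensorProduct.map (autMap g) (autMap g))

/-- `Fix(G)` for the full automorphism group `G = Aut(Γ)`. -/
def autFix {X : Type} [Fintype X] [DecidableEq X] (Γ : SimpleGraph X) :
    Submodule ℂ (StdCube X) where
  carrier := {v | ∀ g : Γ ≃g Γ, autMap3 g v = v}
  add_mem' := fun ha hb g => by rw [map_add, ha g, hb g]
  zero_mem' := fun g => map_zero _
  smul_mem' := fun c v hv g => by rw [map_smul, hv g]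

/-- The set of orbits of `Aut(Γ)` on triples of vertices (the action is diagonal). -/
abbrev TripleOrbit {X : Type} (Γ : SimpleGraph X) : Type :=
  MulAction.orbitRel.Quotient (Γ ≃g Γ) (X × X × X)

/-- The orbit of a triple. -/
abbrev tripleOrbit {X : Type} (Γ : SimpleGraph X) (t : X × X × X) : TripleOrbit Γ :=
  Quotient.mk (MulAction.orbitRel (Γ ≃g Γ) (X × X × X)) t

open Classical in
/-- The characteristic vector of an orbit: the sum of the `x ⊗ y ⊗ z` with `(x, y, z)` in it. -/
def orbitVec {X : Type} [Fintype X] [DecidableEq X] {Γ : SimpleGraph X} (Ω : TripleOrbit Γ) :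
    StdCube X :=
  ∑ t : X × X × X with tripleOrbit Γ t = Ω, vtx3 t

end

/-! ### The Hamming graph -/

/-- The vertices of `H(D,N)`: the `D`-tuples with entries in an `N`-element set. -/
abbrev HamVertex (D N : ℕ) : Type := Fin D → Fin N

/-- The Hamming graph `H(D,N)`: two tuples are adjacent when they differ in exactly one
coordinate. -/
def hammingGraph (D N : ℕ) : SimpleGraph (HamVertex D N) where
  Adj x y := hammingDist x y = 1
  symm := ⟨fun x y h => by rwa [hammingDist_comm]⟩
  loopless := ⟨fun x h => by simp at h⟩

instance (D N : ℕ) : DecidableRel (hammingGraph D N).Adj :=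
  fun x y => inferInstanceAs (Decidable (hammingDist x y = 1))

/-- The (dual) eigenvalue sequence of `H(D,N)`: `θ_i = θ*_i = D (N - 1) - i N`. -/
def hamTheta (D N : ℕ) (i : ℕ) : ℂ := (D : ℂ) * ((N : ℂ) - 1) - (i : ℂ) * (N : ℂ)

/-- The set of profiles: the sequences of five natural numbers with sum `D`. -/
abbrev Profile (D : ℕ) : Type := {d : Fin 5 → ℕ // ∑ i, d i = D}

/-- The numbers `d₁, …, d₅` of a triple `(x, y, z)` of vertices of `H(D,N)`. -/
def tripleProfile {D N : ℕ} (t : HamVertex D N × HamVertex D N × HamVertex D N) : Fin 5 → ℕ :=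
  ![Fintype.card {i // t.1 i = t.2.1 i ∧ t.2.1 i = t.2.2 i},
    Fintype.card {i // t.1 i ≠ t.2.1 i ∧ t.2.1 i = t.2.2 i},
    Fintype.card {i // t.2.1 i ≠ t.2.2 i ∧ t.2.2 i = t.1 i},
    Fintype.card {i // t.2.2 i ≠ t.1 i ∧ t.1 i = t.2.1 i},
    Fintype.card {i // t.1 i ≠ t.2.1 i ∧ t.2.1 i ≠ t.2.2 i ∧ t.2.2 i ≠ t.1 i}]

/-! ### The algebra acts on the tensor cube of the Hamming graph -/

theorem hammingGraph_exists_walk {D N : ℕ} : ∀ (n : ℕ) (x y : HamVertex D N),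
    hammingDist x y = n → ∃ p : (hammingGraph D N).Walk x y, p.length = n
  | 0, x, y, h => by
    obtain rfl := hammingDist_eq_zero.mp h
    exact ⟨.nil, rfl⟩
  | n + 1, x, y, h => by
    have hne : x ≠ y := by
      rintro rfl
      simp at h
    obtain ⟨k, hk⟩ := Function.ne_iff.mp hne
    have h1 : hammingDist x (Function.update x k (y k)) = 1 := by
      unfold hammingDist
      rw [Finset.card_eq_one]
      refine ⟨k, ?_⟩
      ext i
      by_cases hi : i = k
      · subst hi; simpa using hk
      · simp [hi]
    have h2 : hammingDist (Function.update x k (y k)) y = n := by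
      unfold hammingDist at h ⊢
      have : ({i | Function.update x k (y k) i ≠ y i} : Finset (Fin D))
          = ({i | x i ≠ y i} : Finset (Fin D)).erase k := by
        ext i
        by_cases hi : i = k
        · subst hi; simp
        · simp [hi]
      rw [this, Finset.card_erase_of_mem (by simpa using hk), h]
      rfl
    obtain ⟨p, hp⟩ := hammingGraph_exists_walk n _ _ h2
    exact ⟨.cons (show (hammingGraph D N).Adj _ _ from h1) p, by simp [hp]⟩

theorem hammingDist_le_length {D N : ℕ} {x y : HamVertex D N}
    (p : (hammingGraph D N).Walk x y) : hammingDist x y ≤ p.length := by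
  induction p with
  | nil => simp
  | @cons u v w h p ih =>
    have h1 : hammingDist u v = 1 := h
    have := hammingDist_triangle u v w
    simp only [SimpleGraph.Walk.length_cons]
    omega

/-- The path-length distance of `H(D,N)` is the number of coordinates that differ. -/
theorem hammingGraph_dist {D N : ℕ} (x y : HamVertex D N) :
    (hammingGraph D N).dist x y = hammingDist x y := by
  obtain ⟨p, hp⟩ := hammingGraph_exists_walk _ x y rfl
  apply le_antisymm
  · rw [← hp]; exact SimpleGraph.dist_le p
  · obtain ⟨q, hq⟩ := (SimpleGraph.Walk.reachable p).exists_walk_length_eq_dist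
    rw [← hq]; exact hammingDist_le_length q

theorem hammingGraph_sum_nbr {D N : ℕ} {M : Type*} [AddCommGroup M] (x : HamVertex D N)
    (f : HamVertex D N → M) :
    ∑ ξ ∈ (hammingGraph D N).neighborFinset x, f ξ
      = (∑ k : Fin D, ∑ c : Fin N, f (Function.update x k c)) - D • f x := by
  have key : ∑ ξ ∈ (hammingGraph D N).neighborFinset x, f ξ
      = ∑ k : Fin D, ∑ c ∈ Finset.univ.erase (x k), f (Function.update x k c) := by
    rw [Finset.sum_sigma']
    symm
    refine Finset.sum_bij (fun a _ => Function.update x a.1 a.2) ?_ ?_ ?_ ?_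
    · rintro ⟨k, c⟩ h
      simp only [Finset.mem_sigma, Finset.mem_univ, Finset.mem_erase, true_and, and_true] at h
      rw [SimpleGraph.mem_neighborFinset]
      change hammingDist x _ = 1
      unfold hammingDist
      rw [Finset.card_eq_one]
      refine ⟨k, ?_⟩
      ext i
      by_cases hi : i = k
      · subst hi; simpa using h.symm
      · simp [hi]
    · rintro ⟨k, c⟩ h ⟨l, d⟩ h' e
      simp only [Finset.mem_sigma, Finset.mem_univ, Finset.mem_erase, true_and, and_true] at h h'
      dsimp only at e
      have hkl : k = l := by
        by_contra hkl
        have := congrFun e k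
        rw [Function.update_self, Function.update_of_ne hkl] at this
        exact h this
      subst hkl
      have := congrFun e k
      simp only [Function.update_self] at this
      rw [this]
    · intro ξ h
      rw [SimpleGraph.mem_neighborFinset] at h
      change hammingDist x ξ = 1 at h
      unfold hammingDist at h
      obtain ⟨k, hk⟩ := Finset.card_eq_one.mp h
      have hk' : ∀ i, x i ≠ ξ i ↔ i = k := fun i => by
        have := Finset.ext_iff.mp hk i
        simpa using this
      refine ⟨⟨k, ξ k⟩, ?_, ?_⟩
      · simpa using ((hk' k).mpr rfl).symm
      · ext1 i
        by_cases hi : i = k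
        · subst hi; simp
        · rw [Function.update_of_ne hi]
          by_contra hne
          exact hi ((hk' i).mp hne)
    · intros; rfl
  rw [key]
  have : ∀ k : Fin D, ∑ c ∈ Finset.univ.erase (x k), f (Function.update x k c)
      = (∑ c : Fin N, f (Function.update x k c)) - f x := fun k => by
    rw [← Finset.sum_erase_add Finset.univ (fun c => f (Function.update x k c))
      (Finset.mem_univ (x k))]
    simp
  simp [this, Finset.sum_sub_distrib]

theorem hamTheta_dist {D N : ℕ} (x y : HamVertex D N) :
    hamTheta D N ((hammingGraph D N).dist x y)
      = (∑ k : Fin D, if x k = y k then (N : ℂ) else 0) - D := by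
  rw [hammingGraph_dist]
  have h : (hammingDist x y : ℂ) = ∑ k : Fin D, if x k = y k then (0 : ℂ) else 1 := by
    unfold hammingDist
    rw [Finset.card_filter]
    push_cast
    refine Finset.sum_congr rfl fun k _ => ?_
    by_cases hk : x k = y k <;> simp [hk]
  rw [hamTheta, h, Finset.sum_mul]
  have : ∀ k : Fin D, (if x k = y k then (N : ℂ) else 0)
      = N - (if x k = y k then (0 : ℂ) else 1) * N := fun k => by
    by_cases hk : x k = y k <;> simp [hk]
  simp only [this, Finset.sum_sub_distrib]
  simp
  ring

/-- A local-to-global form of the cubic commutator identity. -/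
theorem cubic_comm_of_sum {R : Type*} [Ring R] [Algebra ℂ R] {ι : Type*} [Fintype ι]
    (P Q : ι → R) (n c d : ℂ) (hPP : ∀ i, P i * P i = n • P i)
    (hPc : ∀ i j, Commute (P i) (P j)) (hPQ : ∀ i j, i ≠ j → Commute (P i) (Q j))
    (A B : R) (hA : A = ∑ i, P i - c • (1 : R)) (hB : B = ∑ i, Q i - d • (1 : R)) :
    ⁅A, A ^ 2 * B - (2 : ℂ) • (A * B * A) + B * A ^ 2 - (0 : ℂ) • (A * B + B * A)
      - (n ^ 2) • B⁆ = 0 := by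
  have e1 : ∀ X : R, (2 : ℂ) • X = X + X := fun X => two_smul ℂ X
  have hc : ∀ X : R, ⁅A, X⁆ = ∑ i, ⁅P i, X⁆ := fun X => by
    simp only [hA, Ring.lie_def, sub_mul, mul_sub, Finset.sum_mul, Finset.mul_sum,
      Finset.sum_sub_distrib, smul_mul_assoc, mul_smul_comm, one_mul, mul_one]
    abel
  have hd : ∀ X : R, ⁅X, B⁆ = ∑ i, ⁅X, Q i⁆ := fun X => by
    simp only [hB, Ring.lie_def, sub_mul, mul_sub, Finset.sum_mul, Finset.mul_sum,
      Finset.sum_sub_distrib, smul_mul_assoc, mul_smul_comm, one_mul, mul_one]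
    abel
  have hcom : ∀ i X, (∀ j, j ≠ i → Commute (P j) X) → ⁅A, X⁆ = ⁅P i, X⁆ := fun i X h => by
    rw [hc, Finset.sum_eq_single i]
    · intro j _ hj
      rw [Ring.lie_def, (h j hj).eq, sub_self]
    · simp
  have s1 : ⁅A, B⁆ = ∑ i, ⁅P i, Q i⁆ := by
    rw [hd]
    exact Finset.sum_congr rfl fun i _ => hcom i _ fun j hj => hPQ j i hj
  have cm : ∀ i j, j ≠ i → ∀ X, Commute (P j) X → Commute (P j) ⁅P i, X⁆ := fun i j _ X h => by
    rw [Ring.lie_def]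
    exact ((hPc j i).mul_right h).sub_right (h.mul_right (hPc j i))
  have lsum : ∀ f : ι → R, ⁅A, ∑ i, f i⁆ = ∑ i, ⁅A, f i⁆ := fun f => by
    simp only [Ring.lie_def, Finset.sum_mul, Finset.mul_sum, Finset.sum_sub_distrib]
  have s2 : ⁅A, ⁅A, B⁆⁆ = ∑ i, ⁅P i, ⁅P i, Q i⁆⁆ := by
    rw [s1, lsum]
    exact Finset.sum_congr rfl fun i _ => hcom i _ fun j hj => cm i j hj _ (hPQ j i hj)
  have s3 : ⁅A, ⁅A, ⁅A, B⁆⁆⁆ = (n ^ 2) • ⁅A, B⁆ := by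
    rw [s2, lsum, s1, Finset.smul_sum]
    refine Finset.sum_congr rfl fun i _ => ?_
    rw [hcom i _ fun j hj => cm i j hj _ (cm i j hj _ (hPQ j i hj))]
    have h2 : ∀ X : R, P i * (P i * X) = n • (P i * X) := fun X => by
      rw [← mul_assoc, hPP, smul_mul_assoc]
    simp only [Ring.lie_def, mul_sub, sub_mul, mul_assoc, hPP, h2, mul_smul_comm, smul_mul_assoc, smul_sub,
      smul_smul, pow_two]
    abel
  have s4 : A ^ 2 * B - (2 : ℂ) • (A * B * A) + B * A ^ 2 - (0 : ℂ) • (A * B + B * A)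
      - (n ^ 2) • B = ⁅A, ⁅A, B⁆⁆ - (n ^ 2) • B := by
    rw [e1, zero_smul, Ring.lie_def, Ring.lie_def]
    noncomm_ring
  rw [s4]
  have s5 : ⁅A, ⁅A, ⁅A, B⁆⁆ - (n ^ 2) • B⁆ = ⁅A, ⁅A, ⁅A, B⁆⁆⁆ - (n ^ 2) • ⁅A, B⁆ := by
    simp only [Ring.lie_def, mul_sub, sub_mul, mul_smul_comm, smul_mul_assoc, smul_sub]
    abel
  rw [s5, s3, sub_self]

noncomputable section

/-- Replace the `k`-th coordinate of the first, second, third vertex by `c`. -/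
def updTriple {D N : ℕ} (r : Fin 3) (k : Fin D) (c : Fin N)
    (t : HamVertex D N × HamVertex D N × HamVertex D N) :
    HamVertex D N × HamVertex D N × HamVertex D N :=
  match r with
  | 0 => (Function.update t.1 k c, t.2.1, t.2.2)
  | 1 => (t.1, Function.update t.2.1 k c, t.2.2)
  | 2 => (t.1, t.2.1, Function.update t.2.2 k c)

/-- The two vertices other than the first, second, third agree in the `k`-th coordinate. -/
def agreeTriple {D N : ℕ} (r : Fin 3) (k : Fin D)
    (t : HamVertex D N × HamVertex D N × HamVertex D N) : ℂ :=
  match r with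
  | 0 => if t.2.1 k = t.2.2 k then N else 0
  | 1 => if t.2.2 k = t.1 k then N else 0
  | 2 => if t.1 k = t.2.1 k then N else 0

/-- The part of `A⁽ʳ⁾` at one coordinate. -/
def nodePart {D N : ℕ} (r : Fin 3) (k : Fin D) : Module.End ℂ (StdCube (HamVertex D N)) :=
  (cubeBasis (HamVertex D N)).constr ℂ fun t => ∑ c : Fin N, vtx3 (updTriple r k c t)

/-- The part of `A*⁽ʳ⁾` at one coordinate. -/
def edgePart {D N : ℕ} (r : Fin 3) (k : Fin D) : Module.End ℂ (StdCube (HamVertex D N)) :=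
  (cubeBasis (HamVertex D N)).constr ℂ fun t => agreeTriple r k t • vtx3 t

theorem nodePart_vtx3 {D N : ℕ} (r : Fin 3) (k : Fin D)
    (t : HamVertex D N × HamVertex D N × HamVertex D N) :
    nodePart r k (vtx3 t) = ∑ c : Fin N, vtx3 (updTriple r k c t) := by
  rw [← cubeBasis_apply t, nodePart, Module.Basis.constr_basis]

theorem edgePart_vtx3 {D N : ℕ} (r : Fin 3) (k : Fin D)
    (t : HamVertex D N × HamVertex D N × HamVertex D N) :
    edgePart r k (vtx3 t) = agreeTriple r k t • vtx3 t := by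
  rw [← cubeBasis_apply t, edgePart, Module.Basis.constr_basis, cubeBasis_apply]

theorem cubeEnd_ext {X : Type} [Fintype X] [DecidableEq X] {S T : Module.End ℂ (StdCube X)}
    (h : ∀ t, S (vtx3 t) = T (vtx3 t)) : S = T :=
  (cubeBasis X).ext fun t => by rw [cubeBasis_apply, h]

theorem nodePart_mul_self {D N : ℕ} (r : Fin 3) (k : Fin D) :
    nodePart r k * nodePart r k = (N : ℂ) • nodePart (N := N) r k := by
  refine cubeEnd_ext fun t => ?_
  have h : ∀ c c' : Fin N, updTriple r k c' (updTriple r k c t) = updTriple r k c' t := by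
    intro c c'
    fin_cases r <;> simp [updTriple]
  simp only [Module.End.mul_apply, nodePart_vtx3, map_sum, h, LinearMap.smul_apply,
    Finset.sum_const, Finset.card_univ, Fintype.card_fin]
  rw [Nat.cast_smul_eq_nsmul]

theorem nodePart_comm {D N : ℕ} (r s : Fin 3) (k l : Fin D) :
    Commute (nodePart (N := N) r k) (nodePart s l) := by
  by_cases hrs : r = s ∧ k = l
  · obtain ⟨rfl, rfl⟩ := hrs
    exact Commute.refl _
  refine cubeEnd_ext fun t => ?_
  have h : ∀ c c' : Fin N,
      updTriple r k c (updTriple s l c' t) = updTriple s l c' (updTriple r k c t) := by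
    intro c c'
    by_cases hkl : k = l
    · subst hkl
      fin_cases r <;> fin_cases s <;> first | rfl | exact absurd ⟨rfl, rfl⟩ hrs
    · fin_cases r <;> fin_cases s <;> simp [updTriple, Function.update_comm hkl]
  simp only [Module.End.mul_apply, nodePart_vtx3, map_sum, h]
  exact Finset.sum_comm

theorem edgePart_mul_self {D N : ℕ} (r : Fin 3) (k : Fin D) :
    edgePart r k * edgePart r k = (N : ℂ) • edgePart (N := N) r k := by
  refine cubeEnd_ext fun t => ?_
  have h : agreeTriple r k t * agreeTriple r k t = (N : ℂ) * agreeTriple r k t := by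
    fin_cases r <;> simp only [agreeTriple] <;> split_ifs <;> simp
  simp only [Module.End.mul_apply, edgePart_vtx3, map_smul, LinearMap.smul_apply, smul_smul, h]

theorem edgePart_comm {D N : ℕ} (r s : Fin 3) (k l : Fin D) :
    Commute (edgePart (N := N) r k) (edgePart s l) := by
  refine cubeEnd_ext fun t => ?_
  simp only [Module.End.mul_apply, edgePart_vtx3, map_smul, smul_smul]
  rw [mul_comm]

theorem nodePart_edgePart_comm {D N : ℕ} (r s : Fin 3) (k l : Fin D) (h : r = s ∨ k ≠ l) :
    Commute (nodePart (N := N) r k) (edgePart s l) := by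
  refine cubeEnd_ext fun t => ?_
  have h : ∀ c : Fin N, agreeTriple s l (updTriple r k c t) = agreeTriple s l t := by
    intro c
    rcases h with rfl | h
    · fin_cases r <;> rfl
    · have h' : l ≠ k := fun e => h e.symm
      fin_cases r <;> fin_cases s <;>
        first | rfl | simp [updTriple, agreeTriple, Function.update_of_ne h']
  simp only [Module.End.mul_apply, edgePart_vtx3, nodePart_vtx3, map_smul, map_sum, h,
    Finset.smul_sum]

theorem nodeMap_eq_sum {D N : ℕ} (r : Fin 3) :
    nodeMap (hammingGraph D N) r = ∑ k : Fin D, nodePart r k - (D : ℂ) • 1 := by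
  refine cubeEnd_ext fun t => ?_
  rw [LinearMap.sub_apply, LinearMap.sum_apply, LinearMap.smul_apply, Module.End.one_apply,
    Nat.cast_smul_eq_nsmul]
  simp only [nodePart_vtx3]
  rw [← cubeBasis_apply t]
  fin_cases r
  · simp only [nodeMap, Module.Basis.constr_basis]
    rw [hammingGraph_sum_nbr t.1 (fun ξ => vtx3 (ξ, t.2.1, t.2.2)), cubeBasis_apply]
    rfl
  · simp only [nodeMap, Module.Basis.constr_basis]
    rw [hammingGraph_sum_nbr t.2.1 (fun ξ => vtx3 (t.1, ξ, t.2.2)), cubeBasis_apply]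
    rfl
  · simp only [nodeMap, Module.Basis.constr_basis]
    rw [hammingGraph_sum_nbr t.2.2 (fun ξ => vtx3 (t.1, t.2.1, ξ)), cubeBasis_apply]
    rfl

theorem edgeMap_eq_sum {D N : ℕ} (r : Fin 3) :
    edgeMap (hammingGraph D N) (hamTheta D N) r = ∑ k : Fin D, edgePart r k - (D : ℂ) • 1 := by
  refine cubeEnd_ext fun t => ?_
  rw [LinearMap.sub_apply, LinearMap.sum_apply, LinearMap.smul_apply, Module.End.one_apply]
  simp only [edgePart_vtx3]
  rw [← Finset.sum_smul, ← sub_smul, ← cubeBasis_apply t]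
  fin_cases r
  · simp only [edgeMap, Module.Basis.constr_basis]
    rw [hamTheta_dist, cubeBasis_apply]
    rfl
  · simp only [edgeMap, Module.Basis.constr_basis]
    rw [hamTheta_dist, cubeBasis_apply]
    rfl
  · simp only [edgeMap, Module.Basis.constr_basis]
    rw [hamTheta_dist, cubeBasis_apply]
    rfl

theorem commute_sum_sub {R : Type*} [Ring R] [Algebra ℂ R] {ι : Type*} [Fintype ι]
    (P Q : ι → R) (c d : ℂ) (h : ∀ i j, Commute (P i) (Q j)) :
    Commute (∑ i, P i - c • (1 : R)) (∑ i, Q i - d • (1 : R)) := by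
  have h1 : Commute (∑ i, P i) (∑ j, Q j) :=
    Commute.sum_left _ _ _ fun i _ => Commute.sum_right _ _ _ fun j _ => h i j
  have h2 : ∀ (X : R) (e : ℂ), Commute X (e • (1 : R)) := fun X e =>
    (Commute.one_right X).smul_right e
  exact (h1.sub_right (h2 _ d)).sub_left ((h2 _ c).symm)

/-- The algebra `𝕋 = 𝕋(β, γ, γ*, ϱ, ϱ*)` attached to `H(D,N)`:
`β = 2`, `γ = γ* = 0`, `ϱ = ϱ* = N²`. -/
abbrev HamT (N : ℕ) : Type := S3TridiagAlgebra (2 : ℂ) 0 0 ((N : ℂ) ^ 2) ((N : ℂ) ^ 2)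

/-- The assignment `A_i ↦ A⁽ⁱ⁾`, `A*_i ↦ A*⁽ⁱ⁾` on the free algebra. -/
def hamFreeAction (D N : ℕ) :
    FreeAlgebra ℂ S3TridiagGen →ₐ[ℂ] Module.End ℂ (StdCube (HamVertex D N)) :=
  FreeAlgebra.lift ℂ (Sum.elim (nodeMap (hammingGraph D N))
    (edgeMap (hammingGraph D N) (hamTheta D N)))

theorem hamFreeAction_rel (D N : ℕ) ⦃a b : FreeAlgebra ℂ S3TridiagGen⦄
    (h : S3TridiagRel (2 : ℂ) 0 0 ((N : ℂ) ^ 2) ((N : ℂ) ^ 2) a b) :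
    hamFreeAction D N a = hamFreeAction D N b := by
  have hA : ∀ i, hamFreeAction D N (freeA ℂ i) = nodeMap (hammingGraph D N) i := fun i => by
    simp [hamFreeAction]
  have hAs : ∀ i, hamFreeAction D N (freeAs ℂ i)
      = edgeMap (hammingGraph D N) (hamTheta D N) i := fun i => by
    simp [hamFreeAction]
  have hlie : ∀ x y, hamFreeAction D N ⁅x, y⁆
      = ⁅hamFreeAction D N x, hamFreeAction D N y⁆ := fun x y => by
    simp only [Ring.lie_def, map_sub, map_mul]
  have hz : ∀ x y : Module.End ℂ (StdCube (HamVertex D N)), Commute x y → ⁅x, y⁆ = 0 :=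
    fun x y h => by rw [Ring.lie_def, h.eq, sub_self]
  cases h with
  | comm_A i j =>
    rw [hlie, hA, hA, map_zero, nodeMap_eq_sum, nodeMap_eq_sum]
    exact hz _ _ (commute_sum_sub _ _ _ _ fun k l => nodePart_comm i j k l)
  | comm_As i j =>
    rw [hlie, hAs, hAs, map_zero, edgeMap_eq_sum, edgeMap_eq_sum]
    exact hz _ _ (commute_sum_sub _ _ _ _ fun k l => edgePart_comm i j k l)
  | comm_A_As i =>
    rw [hlie, hA, hAs, map_zero, nodeMap_eq_sum, edgeMap_eq_sum]
    exact hz _ _ (commute_sum_sub _ _ _ _ fun k l => nodePart_edgePart_comm i i k l (.inl rfl))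
  | tridiag i j hij =>
    rw [hlie, map_zero]
    simp only [map_sub, map_add, map_mul, map_pow, map_smul, hA, hAs]
    exact cubic_comm_of_sum _ _ _ _ _ (fun k => nodePart_mul_self i k)
      (fun k l => nodePart_comm i i k l)
      (fun k l hkl => nodePart_edgePart_comm i j k l (.inr hkl)) _ _
      (nodeMap_eq_sum i) (edgeMap_eq_sum j)
  | tridiag_dual i j hij =>
    rw [hlie, map_zero]
    simp only [map_sub, map_add, map_mul, map_pow, map_smul, hA, hAs]
    exact cubic_comm_of_sum _ _ _ _ _ (fun k => edgePart_mul_self j k)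
      (fun k l => edgePart_comm j j k l)
      (fun k l hkl => (nodePart_edgePart_comm i j l k (.inr hkl.symm)).symm) _ _
      (edgeMap_eq_sum j) (nodeMap_eq_sum i)

/-- The action of `𝕋` on `V ⊗ V ⊗ V`, with `A_i` acting as `A⁽ⁱ⁾` and `A*_i` as `A*⁽ⁱ⁾`. -/
def hamAction (D N : ℕ) : HamT N →ₐ[ℂ] Module.End ℂ (StdCube (HamVertex D N)) :=
  RingQuot.liftAlgHom ℂ ⟨hamFreeAction D N, hamFreeAction_rel D N⟩

theorem hamAction_A (D N : ℕ) (i : Fin 3) :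
    hamAction D N (RingQuot.mkAlgHom ℂ _ (freeA ℂ i)) = nodeMap (hammingGraph D N) i := by
  simp [hamAction, hamFreeAction]

theorem hamAction_As (D N : ℕ) (i : Fin 3) :
    hamAction D N (RingQuot.mkAlgHom ℂ _ (freeAs ℂ i))
      = edgeMap (hammingGraph D N) (hamTheta D N) i := by
  simp [hamAction, hamFreeAction]

/-- `V ⊗ V ⊗ V` as a `𝕋`-module. -/
instance hamModule (D N : ℕ) : Module (HamT N) (StdCube (HamVertex D N)) :=
  Module.compHom (StdCube (HamVertex D N)) (hamAction D N).toRingHom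

theorem hamT_smul_def {D N : ℕ} (a : HamT N) (v : StdCube (HamVertex D N)) :
    a • v = hamAction D N a v := rfl

instance hamModule_isScalarTower (D N : ℕ) :
    IsScalarTower ℂ (HamT N) (StdCube (HamVertex D N)) :=
  ⟨fun c a v => by rw [hamT_smul_def, hamT_smul_def, map_smul, LinearMap.smul_apply]⟩

/-- A fundamental `𝕋`-submodule: an irreducible one that contains `𝟏 ⊗ 𝟏 ⊗ 𝟏`. -/
def IsFundamental {D N : ℕ} (Λ : Submodule (HamT N) (StdCube (HamVertex D N))) : Prop :=
  IsSimpleModule (HamT N) Λ ∧ oneCube (HamVertex D N) ∈ Λ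

end

/-! Each coordinate of a triple is in one of five equality states, and the profile counts the
coordinates in each state. On a vector whose coefficient at a triple is a function `g` of its
profile, the generators act through `g`: `A*_s + D` multiplies it by `N` times the number of
coordinates where the two vertices other than the `s`-th agree (`edgeMap_profileVec`), and `A_r + D`
sums over all ways to change the state of one coordinate through the `r`-th vertex
(`nodeMap_profileVec`). So the module is studied as a space of functions on compositions of `D` into
five parts.

The commutator of a pair count with a transfer operator scales the coefficient of each elementary
transfer `i → j` by a difference in `{-1, 0, 1}`. Quadratic polynomials in such commutators isolate
single elementary transfers (`isStable_unit`), and here `N ≥ 3` keeps the rates nonzero. From any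
nonzero function, elementary transfers empty the counters 4, 1, 2, 3 and leave the indicator of
`(D,0,0,0,0)`; the reverse moves then produce the indicator of every profile
(`single_mem_of_stable`). Hence a stable space that contains one nonzero profile vector contains all
of them (`profileVec_single_mem`).

This is used twice. Applied to `Fix(G)`, which is stable and contains `𝟏 ⊗ 𝟏 ⊗ 𝟏`, it shows that
automorphisms preserve profiles, without a classification of the automorphisms. Conversely,
permuting coordinates and the letters in each coordinate relates any two triples of equal profile.
So orbits are profiles, and `Fix(G)` consists of the profile vectors. Applied to a nonzero submodule
of `Fix(G)`, it gives irreducibility. Uniqueness follows since distinct irreducible submodules meet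
in zero, and the dimension is a stars-and-bars count. -/

/-! ### Transfer operators on functions of five counters -/

noncomputable section

/-- Move one unit from the `i`-th to the `j`-th counter. -/
def moveUnit (i j : Fin 5) (e : Fin 5 → ℕ) : Fin 5 → ℕ := e - Pi.single i 1 + Pi.single j 1

theorem moveUnit_sum {i j : Fin 5} {e : Fin 5 → ℕ} (h : 0 < e i) :
    ∑ l, moveUnit i j e l = ∑ l, e l := by
  have h1 : Pi.single i 1 ≤ e := by
    intro l
    by_cases hl : l = i
    · subst hl; simpa using Nat.succ_le_of_lt h
    · simp [hl]
  have h2 := congrArg (fun f : Fin 5 → ℕ => ∑ l, f l) (tsub_add_cancel_of_le h1)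
  simp only [Pi.add_apply, Finset.sum_add_distrib, Finset.sum_pi_single', Finset.mem_univ,
    if_true] at h2
  simp only [moveUnit, Pi.add_apply, Finset.sum_add_distrib, Finset.sum_pi_single',
    Finset.mem_univ, if_true]
  exact h2

theorem moveUnit_source {i j : Fin 5} (hij : i ≠ j) (e : Fin 5 → ℕ) :
    moveUnit i j e i = e i - 1 := by
  simp [moveUnit, hij]

theorem moveUnit_target {i j : Fin 5} (hij : i ≠ j) (e : Fin 5 → ℕ) :
    moveUnit i j e j = e j + 1 := by
  simp [moveUnit, hij.symm]

theorem moveUnit_other {i j l : Fin 5} (hi : l ≠ i) (hj : l ≠ j) (e : Fin 5 → ℕ) :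
    moveUnit i j e l = e l := by
  simp [moveUnit, hi, hj]

theorem moveUnit_moveUnit {i j : Fin 5} (hij : i ≠ j) {e : Fin 5 → ℕ} (h : 0 < e i) :
    moveUnit j i (moveUnit i j e) = e := by
  funext l
  by_cases hi : l = i
  · subst hi
    rw [moveUnit_target hij.symm, moveUnit_source hij]
    omega
  · by_cases hj : l = j
    · subst hj
      rw [moveUnit_source hij.symm, moveUnit_target hij]
      omega
    · rw [moveUnit_other hj hi, moveUnit_other hi hj]

/-- The operator `g ↦ (e ↦ ∑ c i j e_i g(e - δ_i + δ_j))`. -/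
def transferOp (c : Fin 5 → Fin 5 → ℂ) : Module.End ℂ ((Fin 5 → ℕ) → ℂ) where
  toFun g e := ∑ i, ∑ j, c i j * e i * g (moveUnit i j e)
  map_add' g g' := by
    funext e
    simp only [Pi.add_apply, mul_add, Finset.sum_add_distrib]
  map_smul' a g := by
    funext e
    simp only [Pi.smul_apply, smul_eq_mul, RingHom.id_apply, Finset.mul_sum]
    refine Finset.sum_congr rfl fun i _ => Finset.sum_congr rfl fun j _ => ?_
    ring

theorem transferOp_apply (c : Fin 5 → Fin 5 → ℂ) (g : (Fin 5 → ℕ) → ℂ) (e : Fin 5 → ℕ) :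
    transferOp c g e = ∑ i, ∑ j, c i j * e i * g (moveUnit i j e) := rfl

theorem transferOp_add (c c' : Fin 5 → Fin 5 → ℂ) :
    transferOp (c + c') = transferOp c + transferOp c' := by
  ext g e
  simp only [transferOp_apply, LinearMap.add_apply, Pi.add_apply, add_mul, Finset.sum_add_distrib]

theorem transferOp_smul (a : ℂ) (c : Fin 5 → Fin 5 → ℂ) :
    transferOp (a • c) = a • transferOp c := by
  ext g e
  simp only [transferOp_apply, LinearMap.smul_apply, Pi.smul_apply, smul_eq_mul, Finset.mul_sum,
    mul_assoc]

/-- The coefficient function of an elementary transfer. -/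
def unitCoeff (i j : Fin 5) : Fin 5 → Fin 5 → ℂ := fun a b => if a = i ∧ b = j then 1 else 0

theorem transferOp_unitCoeff (i j : Fin 5) (g : (Fin 5 → ℕ) → ℂ) (e : Fin 5 → ℕ) :
    transferOp (unitCoeff i j) g e = e i * g (moveUnit i j e) := by
  rw [transferOp_apply, Finset.sum_eq_single i, Finset.sum_eq_single j]
  · simp [unitCoeff]
  · intro b _ hb
    simp [unitCoeff, hb]
  · simp
  · intro a _ ha
    simp [unitCoeff, ha]
  · simp

/-- The state in which exactly the two vertices other than the `s`-th one agree. -/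
def pairState : Fin 3 → Fin 5 := ![1, 2, 3]

/-- The indicator of the two states in which the vertices other than the `s`-th one agree. -/
def pairWeight (s : Fin 3) (i : Fin 5) : ℂ := if i = 0 ∨ i = pairState s then 1 else 0

/-- The number of coordinates in which the vertices other than the `s`-th one agree. -/
def pairCount (s : Fin 3) (e : Fin 5 → ℕ) : ℂ := ∑ l, pairWeight s l * e l

theorem pairCount_moveUnit (s : Fin 3) {i : Fin 5} (j : Fin 5) {e : Fin 5 → ℕ} (h : 0 < e i) :
    pairCount s (moveUnit i j e) = pairCount s e - pairWeight s i + pairWeight s j := by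
  have key : ∀ l, (moveUnit i j e l : ℂ)
      = e l - (if l = i then 1 else 0) + (if l = j then 1 else 0) := by
    intro l
    simp only [moveUnit, Pi.add_apply, Pi.sub_apply, Nat.cast_add, Pi.single_apply]
    by_cases hl : l = i
    · subst hl
      rw [if_pos rfl, if_pos rfl, Nat.cast_sub h]
      by_cases hj : l = j <;> simp [hj]
    · rw [if_neg hl, if_neg hl]
      by_cases hj : l = j <;> simp [hj]
  simp only [pairCount, key, mul_add, mul_sub, Finset.sum_add_distrib, Finset.sum_sub_distrib]
  simp

/-- A subspace is stable under an endomorphism. -/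
def IsStable {M : Type*} [AddCommGroup M] [Module ℂ M] (W : Submodule ℂ M)
    (T : Module.End ℂ M) : Prop := ∀ g ∈ W, T g ∈ W

theorem IsStable.add {M : Type*} [AddCommGroup M] [Module ℂ M] {W : Submodule ℂ M}
    {S T : Module.End ℂ M} (hS : IsStable W S) (hT : IsStable W T) : IsStable W (S + T) :=
  fun g hg => W.add_mem (hS g hg) (hT g hg)

theorem IsStable.smul {M : Type*} [AddCommGroup M] [Module ℂ M] {W : Submodule ℂ M}
    {T : Module.End ℂ M} (hT : IsStable W T) (a : ℂ) : IsStable W (a • T) :=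
  fun g hg => W.smul_mem a (hT g hg)

/-- The new operator is the commutator of multiplication by `pairCount s` with `transferOp c`:
moving a unit from `i` to `j` changes the pair count by a constant that depends on `i` and `j` only.
-/
theorem IsStable.transfer_weight {W : Submodule ℂ ((Fin 5 → ℕ) → ℂ)} {s : Fin 3}
    (hs : ∀ g ∈ W, pairCount s * g ∈ W) {c : Fin 5 → Fin 5 → ℂ} (hc : IsStable W (transferOp c)) :
    IsStable W (transferOp fun i j => (pairWeight s i - pairWeight s j) * c i j) := by
  intro g hg
  have h := W.sub_mem (hs _ (hc g hg)) (hc _ (hs g hg))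
  convert h using 1
  funext e
  simp only [Pi.sub_apply, Pi.mul_apply, transferOp_apply, Finset.mul_sum,
    ← Finset.sum_sub_distrib]
  refine Finset.sum_congr rfl fun i _ => Finset.sum_congr rfl fun j _ => ?_
  -- If `e i = 0`, the truncated subtraction in `moveUnit` breaks the count formula, but the factor
  -- `e i` kills the term.
  rcases Nat.eq_zero_or_pos (e i) with h0 | h0
  · simp [h0]
  · rw [pairCount_moveUnit s j h0]
    ring

/-- Stability under a quadratic polynomial in the commutator with a pair count. -/
theorem IsStable.transfer_signed {W : Submodule ℂ ((Fin 5 → ℕ) → ℂ)} {s : Fin 3}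
    (hs : ∀ g ∈ W, pairCount s * g ∈ W) {c : Fin 5 → Fin 5 → ℂ} (hc : IsStable W (transferOp c))
    (a b : ℂ) :
    IsStable W (transferOp fun i j => ((pairWeight s i - pairWeight s j) ^ 2
      + a * (pairWeight s i - pairWeight s j) + b) * c i j) := by
  have h1 := hc.transfer_weight hs
  have h := ((h1.transfer_weight hs).add (h1.smul a)).add (hc.smul b)
  rw [← transferOp_smul, ← transferOp_smul, ← transferOp_add, ← transferOp_add] at h
  convert h using 2
  funext i j
  simp only [Pi.add_apply, Pi.smul_apply, smul_eq_mul]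
  ring

/-- The number of ways to change the `r`-th vertex in one coordinate, from state `i`
to state `j`. -/
def stateRate (N : ℕ) (r : Fin 3) (i j : Fin 5) : ℂ :=
  if i = 0 ∨ i = pairState r then
    if j = 0 then 1 else if j = pairState r then (N : ℂ) - 1 else 0
  else if j = 0 ∨ j = pairState r then 0 else if j = 4 then (N : ℂ) - 2 else 1

theorem IsStable.of_smul {M : Type*} [AddCommGroup M] [Module ℂ M] {W : Submodule ℂ M}
    {T : Module.End ℂ M} {a : ℂ} (ha : a ≠ 0) (hT : IsStable W (a • T)) : IsStable W T := by
  have := hT.smul a⁻¹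
  rwa [smul_smul, inv_mul_cancel₀ ha, one_smul] at this

/-- Weight differences take only the values -1, 0, 1, so a quadratic can single out one of them.
Prescribing the differences for two indices `s` and `s'` is enough to cut the rate matrix down to
one entry. -/
theorem isStable_unit_of_rate {N : ℕ} {W : Submodule ℂ ((Fin 5 → ℕ) → ℂ)}
    (hs : ∀ s, ∀ g ∈ W, pairCount s * g ∈ W) {r : Fin 3}
    (hr : IsStable W (transferOp (stateRate N r))) (s s' : Fin 3) (a b a' b' k : ℂ) (i j : Fin 5)
    (hk : k ≠ 0)
    (h : ∀ x y, ((pairWeight s' x - pairWeight s' y) ^ 2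
      + a' * (pairWeight s' x - pairWeight s' y) + b') * (((pairWeight s x - pairWeight s y) ^ 2
      + a * (pairWeight s x - pairWeight s y) + b) * stateRate N r x y) = k * unitCoeff i j x y) :
    IsStable W (transferOp (unitCoeff i j)) := by
  refine IsStable.of_smul hk ?_
  rw [← transferOp_smul]
  convert (hr.transfer_signed (hs s) a b).transfer_signed (hs s') a' b' using 2
  funext x y
  exact (h x y).symm

/-- Among the transitions allowed by `stateRate N r`, the one from 0 to `pairState r` is the only
one with differences (1, 1) for the two indices other than `r`, and its reverse the only one with
(-1, -1). For `r = 1`, the transitions `1 → 4` and `4 → 1` are characterised by (1, 0) and (-1, 0)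
for the indices 0 and 2. -/
theorem isStable_unit {N : ℕ} (hN : 3 ≤ N) {W : Submodule ℂ ((Fin 5 → ℕ) → ℂ)}
    (hs : ∀ s, ∀ g ∈ W, pairCount s * g ∈ W)
    (hr : ∀ r, IsStable W (transferOp (stateRate N r))) :
    (∀ r, IsStable W (transferOp (unitCoeff 0 (pairState r)))) ∧
    (∀ r, IsStable W (transferOp (unitCoeff (pairState r) 0))) ∧
    IsStable W (transferOp (unitCoeff 1 4)) ∧ IsStable W (transferOp (unitCoeff 4 1)) := by
  have h1 : (N : ℂ) - 1 ≠ 0 := by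
    rw [sub_ne_zero]; exact_mod_cast (by omega : N ≠ 1)
  have h2 : (N : ℂ) - 2 ≠ 0 := by
    rw [sub_ne_zero]; exact_mod_cast (by omega : N ≠ 2)
  have h4 : (4 : ℂ) ≠ 0 := by norm_num
  refine ⟨fun r => ?_, fun r => ?_, ?_, ?_⟩
  -- The polynomial `x² + x` vanishes at 0 and -1 and equals 2 at 1; the constant is `2 · 2` times
  -- the rate `N - 1`. For the reverse move, `x² - x` plays this role, with rate 1.
  · refine isStable_unit_of_rate hs (hr r) (r + 1) (r + 2) 1 0 1 0 (4 * ((N : ℂ) - 1)) _ _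
      (mul_ne_zero h4 h1) fun x y => ?_
    fin_cases r <;> fin_cases x <;> fin_cases y <;>
      simp [pairWeight, pairState, stateRate, unitCoeff] <;> ring
  · refine isStable_unit_of_rate hs (hr r) (r + 1) (r + 2) (-1) 0 (-1) 0 4 _ _ h4 fun x y => ?_
    fin_cases r <;> fin_cases x <;> fin_cases y <;>
      simp [pairWeight, pairState, stateRate, unitCoeff] <;> ring
  -- The second factor is `x² - 1`, which keeps only the difference 0, with value -1; the rate of `1
  -- → 4` is `N - 2`.
  · refine isStable_unit_of_rate hs (hr 1) 0 2 1 0 0 (-1) (-2 * ((N : ℂ) - 2)) _ _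
      (mul_ne_zero (by norm_num) h2) fun x y => ?_
    fin_cases x <;> fin_cases y <;>
      simp [pairWeight, pairState, stateRate, unitCoeff]
    norm_num
  · refine isStable_unit_of_rate hs (hr 1) 0 2 (-1) 0 0 (-1) (-2) _ _
      (by norm_num) fun x y => ?_
    fin_cases x <;> fin_cases y <;>
      simp [pairWeight, pairState, stateRate, unitCoeff]
    ring

/-- Elementary transfers from `i` to `j` push a nonzero function off the counters `j`, and keep
the other counters that vanish. -/
theorem exists_mem_counter_zero {D : ℕ} {W : Submodule ℂ ((Fin 5 → ℕ) → ℂ)} {i j : Fin 5}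
    (hij : i ≠ j) (hX : IsStable W (transferOp (unitCoeff i j))) {Z : Finset (Fin 5)} (hi : i ∉ Z)
    (n : ℕ) : ∀ g ∈ W, g ≠ 0 → (∀ e, g e ≠ 0 → ∑ l, e l = D ∧ ∀ l ∈ Z, e l = 0) →
      (∀ e, g e ≠ 0 → e j ≤ n) →
      ∃ g ∈ W, g ≠ 0 ∧ ∀ e, g e ≠ 0 → ∑ l, e l = D ∧ ∀ l ∈ insert j Z, e l = 0 := by
  induction n with
  | zero =>
    intro g hg h0 hZ hj
    refine ⟨g, hg, h0, fun e he => ⟨(hZ e he).1, fun l hl => ?_⟩⟩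
    rcases Finset.mem_insert.mp hl with rfl | hl
    · exact Nat.le_zero.mp (hj e he)
    · exact (hZ e he).2 l hl
  | succ n ih =>
    intro g hg h0 hZ hj
    by_cases hn : ∃ e, g e ≠ 0 ∧ e j = n + 1
    · obtain ⟨e, he, hen⟩ := hn
      have hpos : ∀ e', transferOp (unitCoeff i j) g e' ≠ 0 → 0 < e' i ∧ g (moveUnit i j e') ≠ 0 := by
        intro e' h
        rw [transferOp_unitCoeff] at h
        exact ⟨Nat.pos_of_ne_zero (by exact_mod_cast left_ne_zero_of_mul h),
          right_ne_zero_of_mul h⟩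
      refine ih _ (hX g hg) ?_ ?_ ?_
      · intro h
        -- The transfer pulls the support from `j` back to `i`. Since `e` has the largest value of
        -- counter `j`, its image shows that the result is nonzero, while that maximum drops by one.
        have := congrFun h (moveUnit j i e)
        rw [transferOp_unitCoeff, moveUnit_moveUnit hij.symm (by omega), moveUnit_target hij.symm,
          Pi.zero_apply] at this
        exact mul_ne_zero (Nat.cast_ne_zero.mpr (Nat.succ_ne_zero _)) he this
      · intro e' h
        obtain ⟨hp, h⟩ := hpos e' h
        obtain ⟨hD, hz⟩ := hZ _ h
        refine ⟨by rw [← hD, moveUnit_sum hp], fun l hl => ?_⟩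
        have hli : l ≠ i := fun h => hi (h ▸ hl)
        have := hz l hl
        by_cases hlj : l = j
        · subst hlj
          rw [moveUnit_target hij] at this
          omega
        · rwa [moveUnit_other hli hlj] at this
      · intro e' h
        have := hj _ (hpos e' h).2
        rw [moveUnit_target hij] at this
        omega
    · push Not at hn
      exact ih g hg h0 hZ fun e he => by
        have := hj e he
        have := hn e he
        omega

theorem exists_mem_insert_counter_zero {D : ℕ} {W : Submodule ℂ ((Fin 5 → ℕ) → ℂ)} {i j : Fin 5}
    (hij : i ≠ j) (hX : IsStable W (transferOp (unitCoeff i j))) {Z : Finset (Fin 5)} (hi : i ∉ Z)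
    {g : (Fin 5 → ℕ) → ℂ} (hg : g ∈ W) (h0 : g ≠ 0)
    (hZ : ∀ e, g e ≠ 0 → ∑ l, e l = D ∧ ∀ l ∈ Z, e l = 0) :
    ∃ g ∈ W, g ≠ 0 ∧ ∀ e, g e ≠ 0 → ∑ l, e l = D ∧ ∀ l ∈ insert j Z, e l = 0 :=
  exists_mem_counter_zero hij hX hi D g hg h0 hZ fun e he => by
    rw [← (hZ e he).1]
    exact Finset.single_le_sum (f := e) (fun _ _ => Nat.zero_le _) (Finset.mem_univ j)

/-- The elementary transfer `i → j` acts on functions against the move: it sends the indicator of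
the moved composition to `e i` times the indicator of `e`. -/
theorem single_mem_of_moveUnit {W : Submodule ℂ ((Fin 5 → ℕ) → ℂ)} {i j : Fin 5}
    (hij : i ≠ j) (hX : IsStable W (transferOp (unitCoeff i j))) {e : Fin 5 → ℕ} (he : 0 < e i)
    (h : (Pi.single (moveUnit i j e) 1 : (Fin 5 → ℕ) → ℂ) ∈ W) :
    (Pi.single e 1 : (Fin 5 → ℕ) → ℂ) ∈ W := by
  have h1 : transferOp (unitCoeff i j) (Pi.single (moveUnit i j e) 1)
      = (e i : ℂ) • (Pi.single e 1 : (Fin 5 → ℕ) → ℂ) := by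
    funext a
    rw [transferOp_unitCoeff, Pi.smul_apply, smul_eq_mul]
    by_cases ha : a = e
    · subst ha; simp
    · rw [Pi.single_eq_of_ne ha, mul_zero]
      rcases Nat.eq_zero_or_pos (a i) with h0 | h0
      · simp [h0]
      · rw [Pi.single_eq_of_ne, mul_zero]
        intro h
        apply ha
        rw [← moveUnit_moveUnit hij h0, h, moveUnit_moveUnit hij he]
  have h2 := W.smul_mem (e i : ℂ)⁻¹ (hX _ h)
  rwa [h1, smul_smul, inv_mul_cancel₀ (Nat.cast_ne_zero.mpr he.ne'), one_smul] at h2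

/-- A subspace of functions that is stable under the transfers and the pair counts, and contains
a nonzero function on the profiles, contains all functions on the profiles. -/
theorem single_mem_of_stable {N D : ℕ} (hN : 3 ≤ N) {W : Submodule ℂ ((Fin 5 → ℕ) → ℂ)}
    (hs : ∀ s, ∀ g ∈ W, pairCount s * g ∈ W)
    (hr : ∀ r, IsStable W (transferOp (stateRate N r)))
    {g : (Fin 5 → ℕ) → ℂ} (hg : g ∈ W) (h0 : g ≠ 0) (hD : ∀ e, g e ≠ 0 → ∑ l, e l = D)
    (d : Profile D) : (Pi.single d.1 1 : (Fin 5 → ℕ) → ℂ) ∈ W := by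
  obtain ⟨hdown, hup, h14, h41⟩ := isStable_unit hN hs hr
  have htop : (Pi.single (Pi.single 0 D) 1 : (Fin 5 → ℕ) → ℂ) ∈ W := by
    -- Counter 4 goes first because it is emptied into counter 1, which must not yet be required to
    -- vanish; counters 1, 2, 3 are then emptied into 0.
    obtain ⟨g, hg, h0, hD⟩ := exists_mem_insert_counter_zero (D := D) (Z := ∅) (by decide) h14 (by decide)
      hg h0 (fun e he => ⟨hD e he, by simp⟩)
    obtain ⟨g, hg, h0, hD⟩ := exists_mem_insert_counter_zero (by decide) (hdown 0) (by decide) hg h0 hD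
    obtain ⟨g, hg, h0, hD⟩ := exists_mem_insert_counter_zero (by decide) (hdown 1) (by decide) hg h0 hD
    obtain ⟨g, hg, h0, hD⟩ := exists_mem_insert_counter_zero (by decide) (hdown 2) (by decide) hg h0 hD
    have hsupp : ∀ e, g e ≠ 0 → e = Pi.single 0 D := by
      intro e he
      obtain ⟨hs, hz⟩ := hD e he
      have z1 := hz 1 (by decide)
      have z2 := hz 2 (by decide)
      have z3 := hz 3 (by decide)
      have z4 := hz 4 (by decide)
      rw [Fin.sum_univ_five] at hs
      funext l
      fin_cases l <;> simp [z1, z2, z3, z4]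
      omega
    obtain ⟨e, he⟩ := Function.ne_iff.mp h0
    have he' := hsupp e he
    subst he'
    have h2 := W.smul_mem (g (Pi.single 0 D))⁻¹ hg
    convert h2 using 1
    funext a
    by_cases ha : a = Pi.single 0 D
    · subst ha
      simp [inv_mul_cancel₀ he]
    · rw [Pi.single_eq_of_ne ha, Pi.smul_apply]
      by_contra hne
      exact ha (hsupp a fun h => hne (by simp [h]))
  -- The weight is the number of elementary moves needed to reach `(D,0,0,0,0)`. Counter 4 has
  -- weight 2, since its units pass through state 1.
  suffices h : ∀ (n : ℕ) (e : Fin 5 → ℕ), ∑ l, e l = D → e 1 + e 2 + e 3 + 2 * e 4 = n →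
      (Pi.single e 1 : (Fin 5 → ℕ) → ℂ) ∈ W from h _ d.1 d.2 rfl
  intro n
  induction n using Nat.strong_induction_on with
  | _ n ih =>
    intro e he hn
    have step : ∀ i j : Fin 5, i ≠ j → IsStable W (transferOp (unitCoeff i j)) → 0 < e i →
        (moveUnit i j e 1 + moveUnit i j e 2 + moveUnit i j e 3 + 2 * moveUnit i j e 4 < n) →
        (Pi.single e 1 : (Fin 5 → ℕ) → ℂ) ∈ W := fun i j hij hX hi hlt =>
      single_mem_of_moveUnit hij hX hi (ih _ hlt _ (by rw [moveUnit_sum hi, he]) rfl)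
    rcases Nat.eq_zero_or_pos (e 4) with h4 | h4
    swap
    · refine step 4 1 (by decide) h41 h4 ?_
      simp [moveUnit]; omega
    rcases Nat.eq_zero_or_pos (e 1) with h1 | h1
    swap
    · refine step 1 0 (by decide) (hup 0) h1 ?_
      simp [moveUnit]; omega
    rcases Nat.eq_zero_or_pos (e 2) with h2 | h2
    swap
    · refine step 2 0 (by decide) (hup 1) h2 ?_
      simp [moveUnit]; omega
    rcases Nat.eq_zero_or_pos (e 3) with h3 | h3
    swap
    · refine step 3 0 (by decide) (hup 2) h3 ?_
      simp [moveUnit]; omega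
    have : e = Pi.single 0 D := by
      rw [Fin.sum_univ_five] at he
      funext l
      fin_cases l <;> simp [h1, h2, h3, h4]
      omega
    rw [this]
    exact htop

end

/-! ### Functions of the profile as vectors of the tensor cube -/

noncomputable section

/-- The equality pattern of three elements. -/
def eqState {α : Type*} [DecidableEq α] (a b c : α) : Fin 5 :=
  if b = c then if a = b then 0 else 1
  else if c = a then 2 else if a = b then 3 else 4

/-- The equality pattern of the `k`-th coordinates of a triple. -/
def coordState {D N : ℕ} (t : HamVertex D N × HamVertex D N × HamVertex D N) (k : Fin D) : Fin 5 :=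
  eqState (t.1 k) (t.2.1 k) (t.2.2 k)

theorem tripleProfile_eq_card {D N : ℕ} (t : HamVertex D N × HamVertex D N × HamVertex D N)
    (i : Fin 5) : tripleProfile t i = Fintype.card {k // coordState t k = i} := by
  have h : ∀ (p q : Fin D → Prop) [DecidablePred p] [DecidablePred q], (∀ k, p k ↔ q k) →
      Fintype.card {k // p k} = Fintype.card {k // q k} := fun p q _ _ h =>
    Fintype.card_congr (Equiv.subtypeEquivRight h)
  fin_cases i <;> simp only [tripleProfile, Fin.zero_eta, Fin.mk_one, Fin.reduceFinMk,
    Matrix.cons_val] <;> apply h <;> intro k <;> simp only [coordState, eqState] <;> grind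

theorem tripleProfile_apply {D N : ℕ} (t : HamVertex D N × HamVertex D N × HamVertex D N)
    (i : Fin 5) : tripleProfile t i = ∑ k, if coordState t k = i then 1 else 0 := by
  rw [tripleProfile_eq_card, Fintype.card_subtype, Finset.card_filter]

theorem sum_tripleProfile {D N : ℕ} (t : HamVertex D N × HamVertex D N × HamVertex D N) :
    ∑ i, tripleProfile t i = D := by
  simp only [tripleProfile_apply]
  rw [Finset.sum_comm]
  simp

theorem sum_coordState {D N : ℕ} (t : HamVertex D N × HamVertex D N × HamVertex D N)
    (G : Fin 5 → ℂ) : ∑ k, G (coordState t k) = ∑ i, tripleProfile t i * G i := by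
  simp only [tripleProfile_apply, Nat.cast_sum, Finset.sum_mul]
  rw [Finset.sum_comm]
  refine Finset.sum_congr rfl fun k _ => ?_
  simp

theorem coordState_updTriple_of_ne {D N : ℕ} (r : Fin 3) {k l : Fin D} (h : l ≠ k) (c : Fin N)
    (t : HamVertex D N × HamVertex D N × HamVertex D N) :
    coordState (updTriple r k c t) l = coordState t l := by
  fin_cases r <;> simp [coordState, updTriple, h]

theorem tripleProfile_updTriple {D N : ℕ} (r : Fin 3) (k : Fin D) (c : Fin N)
    (t : HamVertex D N × HamVertex D N × HamVertex D N) :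
    tripleProfile (updTriple r k c t)
      = moveUnit (coordState t k) (coordState (updTriple r k c t) k) (tripleProfile t) := by
  funext i
  have h1 : ∀ u : HamVertex D N × HamVertex D N × HamVertex D N, tripleProfile u i
      = (∑ l ∈ Finset.univ.erase k, if coordState u l = i then 1 else 0)
        + if coordState u k = i then 1 else 0 := fun u => by
    rw [tripleProfile_apply, Finset.sum_erase_add _ _ (Finset.mem_univ k)]
  simp only [moveUnit, Pi.add_apply, Pi.sub_apply, Pi.single_apply, @eq_comm _ i]
  -- Coordinate `k` itself contributes to the counter of its old state, so the truncated subtraction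
  -- is exact.
  rw [h1, h1 t, add_tsub_cancel_right]
  congr 1
  refine Finset.sum_congr rfl fun l hl => ?_
  rw [coordState_updTriple_of_ne r (Finset.ne_of_mem_erase hl)]

theorem sum_ite_eq_two {N : ℕ} {b c : Fin N} (hbc : b ≠ c) (u v w : ℂ) :
    (∑ x : Fin N, if x = b then u else if x = c then v else w) = u + v + ((N : ℂ) - 2) * w := by
  have h : ∀ x : Fin N, (if x = b then u else if x = c then v else w)
      = w + (if x = b then u - w else 0) + (if x = c then v - w else 0) := by
    intro x
    by_cases hb : x = b
    · subst hb; simp [hbc]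
    · rw [if_neg hb, if_neg hb]
      by_cases hc : x = c <;> simp [hc]
  simp only [h, Finset.sum_add_distrib]
  simp
  ring

theorem sum_ite_eq_one {N : ℕ} (b : Fin N) (u w : ℂ) :
    (∑ x : Fin N, if x = b then u else w) = u + ((N : ℂ) - 1) * w := by
  have h : ∀ x : Fin N, (if x = b then u else w) = w + (if x = b then u - w else 0) := by
    intro x
    by_cases hb : x = b <;> simp [hb]
  simp only [h, Finset.sum_add_distrib]
  simp
  ring

/-- If the two fixed letters agree, one new letter gives state 0 and `N - 1` give state 1. Otherwise
one letter matches each of them and `N - 2` match neither. The old letter plays no role beyond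
fixing which of these cases holds. -/
theorem sum_eqState_left {N : ℕ} (a b c : Fin N) (G : Fin 5 → ℂ) :
    ∑ x, G (eqState x b c) = ∑ j, stateRate N 0 (eqState a b c) j * G j := by
  rw [Fin.sum_univ_five]
  by_cases h : b = c
  · have h1 : ∀ x, G (eqState x b c) = if x = b then G 0 else G 1 := by
      intro x; simp only [eqState]; grind
    have h2 : eqState a b c = 0 ∨ eqState a b c = 1 := by simp only [eqState]; grind
    simp only [h1, sum_ite_eq_one]
    rcases h2 with h2 | h2 <;> simp [h2, stateRate, pairState]
  · have h1 : ∀ x, G (eqState x b c) = if x = c then G 2 else if x = b then G 3 else G 4 := by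
      intro x; simp only [eqState]; grind
    have h2 : eqState a b c = 2 ∨ eqState a b c = 3 ∨ eqState a b c = 4 := by
      simp only [eqState]; grind
    simp only [h1, sum_ite_eq_two (Ne.symm h)]
    rcases h2 with h2 | h2 | h2 <;> simp [h2, stateRate, pairState]

theorem sum_eqState_middle {N : ℕ} (a b c : Fin N) (G : Fin 5 → ℂ) :
    ∑ x, G (eqState a x c) = ∑ j, stateRate N 1 (eqState a b c) j * G j := by
  rw [Fin.sum_univ_five]
  by_cases h : c = a
  · have h1 : ∀ x, G (eqState a x c) = if x = a then G 0 else G 2 := by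
      intro x; simp only [eqState]; grind
    have h2 : eqState a b c = 0 ∨ eqState a b c = 2 := by simp only [eqState]; grind
    simp only [h1, sum_ite_eq_one]
    rcases h2 with h2 | h2 <;> simp [h2, stateRate, pairState]
  · have h1 : ∀ x, G (eqState a x c) = if x = c then G 1 else if x = a then G 3 else G 4 := by
      intro x; simp only [eqState]; grind
    have h2 : eqState a b c = 1 ∨ eqState a b c = 3 ∨ eqState a b c = 4 := by
      simp only [eqState]; grind
    simp only [h1, sum_ite_eq_two h]
    rcases h2 with h2 | h2 | h2 <;> simp [h2, stateRate, pairState]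

theorem sum_eqState_right {N : ℕ} (a b c : Fin N) (G : Fin 5 → ℂ) :
    ∑ x, G (eqState a b x) = ∑ j, stateRate N 2 (eqState a b c) j * G j := by
  rw [Fin.sum_univ_five]
  by_cases h : a = b
  · have h1 : ∀ x, G (eqState a b x) = if x = a then G 0 else G 3 := by
      intro x; simp only [eqState]; grind
    have h2 : eqState a b c = 0 ∨ eqState a b c = 3 := by simp only [eqState]; grind
    simp only [h1, sum_ite_eq_one]
    rcases h2 with h2 | h2 <;> simp [h2, stateRate, pairState]
  · have h1 : ∀ x, G (eqState a b x) = if x = b then G 1 else if x = a then G 2 else G 4 := by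
      intro x; simp only [eqState]; grind
    have h2 : eqState a b c = 1 ∨ eqState a b c = 2 ∨ eqState a b c = 4 := by
      simp only [eqState]; grind
    simp only [h1, sum_ite_eq_two (Ne.symm h)]
    rcases h2 with h2 | h2 | h2 <;> simp [h2, stateRate, pairState]

theorem sum_coordState_updTriple {D N : ℕ} (r : Fin 3) (k : Fin D)
    (t : HamVertex D N × HamVertex D N × HamVertex D N) (G : Fin 5 → ℂ) :
    ∑ c : Fin N, G (coordState (updTriple r k c t) k)
      = ∑ j, stateRate N r (coordState t k) j * G j := by
  fin_cases r
  · simpa [coordState, updTriple] using sum_eqState_left (t.1 k) (t.2.1 k) (t.2.2 k) G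
  · simpa [coordState, updTriple] using sum_eqState_middle (t.1 k) (t.2.1 k) (t.2.2 k) G
  · simpa [coordState, updTriple] using sum_eqState_right (t.1 k) (t.2.1 k) (t.2.2 k) G

/-- The vector of the tensor cube with coefficients `g (tripleProfile t)`. -/
def profileVec (D N : ℕ) : ((Fin 5 → ℕ) → ℂ) →ₗ[ℂ] StdCube (HamVertex D N) where
  toFun g := ∑ t, g (tripleProfile t) • vtx3 t
  map_add' g g' := by simp only [Pi.add_apply, add_smul, Finset.sum_add_distrib]
  map_smul' a g := by
    simp only [Pi.smul_apply, smul_eq_mul, mul_smul, RingHom.id_apply, Finset.smul_sum]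

theorem profileVec_apply {D N : ℕ} (g : (Fin 5 → ℕ) → ℂ) :
    profileVec D N g = ∑ t, g (tripleProfile t) • vtx3 t := rfl

theorem profileVec_congr {D N : ℕ} {g g' : (Fin 5 → ℕ) → ℂ}
    (h : ∀ e, ∑ l, e l = D → g e = g' e) : profileVec D N g = profileVec D N g' := by
  rw [profileVec_apply, profileVec_apply]
  exact Finset.sum_congr rfl fun t _ => by rw [h _ (sum_tripleProfile t)]

/-- The `r`-th vertex of a triple. -/
def tripleEntry {D N : ℕ} (r : Fin 3) (t : HamVertex D N × HamVertex D N × HamVertex D N) :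
    HamVertex D N := ![t.1, t.2.1, t.2.2] r

/-- Exchange the `k`-th coordinate of the `r`-th vertex with an external value. -/
def swapEntry {D N : ℕ} (r : Fin 3) (k : Fin D) :
    Equiv.Perm ((HamVertex D N × HamVertex D N × HamVertex D N) × Fin N) :=
  Function.Involutive.toPerm (fun p => (updTriple r k p.2 p.1, tripleEntry r p.1 k)) (by
    rintro ⟨⟨x, y, z⟩, c⟩
    fin_cases r <;> simp [updTriple, tripleEntry])

/-- This is the symmetry of the operator: exchanging the replaced letter with the new one is an
involution on pairs of a triple and a letter, so the sum may be reindexed by the target triple. -/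
theorem nodePart_sum {D N : ℕ} (r : Fin 3) (k : Fin D)
    (f : HamVertex D N × HamVertex D N × HamVertex D N → ℂ) :
    nodePart r k (∑ t, f t • vtx3 t) = ∑ t, (∑ c, f (updTriple r k c t)) • vtx3 t := by
  simp only [map_sum, map_smul, nodePart_vtx3, Finset.smul_sum, Finset.sum_smul]
  rw [← Fintype.sum_prod_type', ← Fintype.sum_prod_type', ← Equiv.sum_comp (swapEntry r k)]
  refine Finset.sum_congr rfl fun p _ => ?_
  have h : updTriple r k (swapEntry r k p).2 (swapEntry r k p).1 = p.1 :=
    congrArg Prod.fst (Function.Involutive.toPerm_involutive _ p : swapEntry r k (swapEntry r k p) = p)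
  rw [h]
  rfl

/-- Grouping the coordinates by state turns the sum over coordinates into the factors `e i`, and
`stateRate` counts the new letters leading to each state. -/
theorem nodeMap_profileVec {D N : ℕ} (r : Fin 3) (g : (Fin 5 → ℕ) → ℂ) :
    nodeMap (hammingGraph D N) r (profileVec D N g)
      = profileVec D N (transferOp (stateRate N r) g - (D : ℂ) • g) := by
  rw [nodeMap_eq_sum, LinearMap.sub_apply, LinearMap.sum_apply, LinearMap.smul_apply,
    Module.End.one_apply, map_sub, map_smul]
  congr 1
  simp only [profileVec_apply, nodePart_sum]
  rw [Finset.sum_comm]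
  refine Finset.sum_congr rfl fun t _ => ?_
  rw [← Finset.sum_smul]
  congr 1
  simp only [tripleProfile_updTriple]
  have h : ∀ k : Fin D, ∑ c : Fin N, g (moveUnit (coordState t k)
      (coordState (updTriple r k c t) k) (tripleProfile t))
        = ∑ j, stateRate N r (coordState t k) j * g (moveUnit (coordState t k) j (tripleProfile t)) :=
    fun k => sum_coordState_updTriple r k t fun j => g (moveUnit (coordState t k) j (tripleProfile t))
  simp only [h]
  rw [sum_coordState t fun i => ∑ j, stateRate N r i j * g (moveUnit i j (tripleProfile t)),
    transferOp_apply]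
  refine Finset.sum_congr rfl fun i _ => ?_
  rw [Finset.mul_sum]
  exact Finset.sum_congr rfl fun j _ => by ring

theorem agreeTriple_eq {D N : ℕ} (s : Fin 3) (k : Fin D)
    (t : HamVertex D N × HamVertex D N × HamVertex D N) :
    agreeTriple s k t = N * pairWeight s (coordState t k) := by
  fin_cases s <;> simp only [agreeTriple, pairWeight, coordState, eqState, pairState] <;>
    split_ifs <;> simp_all

theorem edgeMap_profileVec {D N : ℕ} (s : Fin 3) (g : (Fin 5 → ℕ) → ℂ) :
    edgeMap (hammingGraph D N) (hamTheta D N) s (profileVec D N g)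
      = profileVec D N ((N : ℂ) • (pairCount s * g) - (D : ℂ) • g) := by
  rw [edgeMap_eq_sum, LinearMap.sub_apply, LinearMap.sum_apply, LinearMap.smul_apply,
    Module.End.one_apply, map_sub, map_smul (profileVec D N) (D : ℂ) g]
  congr 1
  rw [profileVec_apply, profileVec_apply]
  simp only [map_sum, map_smul, edgePart_vtx3]
  rw [Finset.sum_comm]
  refine Finset.sum_congr rfl fun t _ => ?_
  rw [← Finset.smul_sum, ← Finset.sum_smul, smul_smul]
  congr 1
  simp only [agreeTriple_eq, ← Finset.mul_sum, sum_coordState t, Pi.smul_apply, Pi.mul_apply,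
    smul_eq_mul, pairCount]
  rw [mul_comm, mul_assoc]
  simp only [mul_comm]

end

/-! ### Triples with equal profiles are related by an automorphism -/

noncomputable section

/-- Equal kernels make `f i ↦ f' i` a well-defined bijection of the ranges, which extends to a
permutation because `α` is finite. -/
theorem exists_perm_apply_eq {ι α : Type*} [Finite α] {f f' : ι → α}
    (h : ∀ i j, f i = f j ↔ f' i = f' j) : ∃ π : Equiv.Perm α, ∀ i, π (f i) = f' i := by
  classical
  let e : {a // a ∈ Set.range f} ≃ {a // a ∈ Set.range f'} :=
    Equiv.ofBijective (fun x => ⟨f' x.2.choose, x.2.choose, rfl⟩) (by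
      constructor
      · intro x y hxy
        have h1 := (h _ _).mpr (congrArg Subtype.val hxy)
        rw [x.2.choose_spec, y.2.choose_spec] at h1
        exact Subtype.ext h1
      · rintro ⟨_, i, rfl⟩
        refine ⟨⟨f i, i, rfl⟩, Subtype.ext ?_⟩
        exact (h _ _).mp (Exists.choose_spec (⟨i, rfl⟩ : f i ∈ Set.range f)))
  refine ⟨e.extendSubtype, fun i => ?_⟩
  rw [e.extendSubtype_apply_of_mem (f i) ⟨i, rfl⟩]
  exact (h _ _).mp (Exists.choose_spec (⟨i, rfl⟩ : f i ∈ Set.range f))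

theorem exists_perm_eqState {α : Type*} [DecidableEq α] [Finite α] {a b c a' b' c' : α}
    (h : eqState a b c = eqState a' b' c') :
    ∃ π : Equiv.Perm α, π a = a' ∧ π b = b' ∧ π c = c' := by
  obtain ⟨π, hπ⟩ := exists_perm_apply_eq (f := ![a, b, c]) (f' := ![a', b', c']) (by
    simp only [eqState] at h
    intro i j
    fin_cases i <;> fin_cases j <;> simp <;> grind)
  exact ⟨π, hπ 0, hπ 1, hπ 2⟩

theorem exists_perm_of_card_fiber {α β : Type*} [Fintype α] [DecidableEq β] {f f' : α → β}
    (h : ∀ b, Fintype.card {a // f a = b} = Fintype.card {a // f' a = b}) :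
    ∃ σ : Equiv.Perm α, ∀ a, f' (σ a) = f a := by
  let e : ∀ b, {a // f a = b} ≃ {a // f' a = b} := fun b => Fintype.equivOfCardEq (h b)
  refine ⟨(Equiv.sigmaFiberEquiv f).symm.trans
    ((Equiv.sigmaCongrRight e).trans (Equiv.sigmaFiberEquiv f')), fun a => ?_⟩
  exact (e (f a) ⟨a, rfl⟩).2

/-- The automorphism of the Hamming graph that permutes the coordinates and the entries of each
coordinate. -/
def hammingAut {D N : ℕ} (σ : Equiv.Perm (Fin D)) (π : Fin D → Equiv.Perm (Fin N)) :
    hammingGraph D N ≃g hammingGraph D N where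
  toFun x k := π (σ.symm k) (x (σ.symm k))
  invFun y k := (π k).symm (y (σ k))
  left_inv x := by funext k; simp
  right_inv y := by funext k; simp
  map_rel_iff' := by
    intro x y
    change hammingDist (fun k => π (σ.symm k) (x (σ.symm k)))
      (fun k => π (σ.symm k) (y (σ.symm k))) = 1 ↔ hammingDist x y = 1
    have : hammingDist (fun k => π (σ.symm k) (x (σ.symm k)))
        (fun k => π (σ.symm k) (y (σ.symm k))) = hammingDist x y := by
      refine Finset.card_equiv σ.symm fun k => ?_
      simp
    rw [this]

/-- Equal profiles allow the coordinates to be matched state by state; in each matched pair of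
columns, a permutation of the letters carries one onto the other. -/
theorem tripleOrbit_eq_of_profile {D N : ℕ}
    {t t' : HamVertex D N × HamVertex D N × HamVertex D N}
    (h : tripleProfile t = tripleProfile t') :
    tripleOrbit (hammingGraph D N) t = tripleOrbit (hammingGraph D N) t' := by
  obtain ⟨σ, hσ⟩ := exists_perm_of_card_fiber (f := coordState t') (f' := coordState t) fun i => by
    rw [← tripleProfile_eq_card, ← tripleProfile_eq_card, h]
  choose π h1 h2 h3 using fun k => exists_perm_eqState (hσ k)
  refine (Quotient.sound (s := MulAction.orbitRel _ _) ?_ : tripleOrbit _ t = tripleOrbit _ t')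
  -- `hammingAut` indexes letter permutations by the source coordinate. Target `k` reads from `σ k`,
  -- so the permutation stored there must be `π k`.
  refine MulAction.mem_orbit_symm.mp ⟨hammingAut σ.symm fun k => π (σ.symm k), ?_⟩
  refine Prod.ext ?_ (Prod.ext ?_ ?_) <;> funext k
  · change π (σ.symm (σ.symm.symm k)) (t.1 (σ.symm.symm k)) = t'.1 k
    simp [h1]
  · change π (σ.symm (σ.symm.symm k)) (t.2.1 (σ.symm.symm k)) = t'.2.1 k
    simp [h2]
  · change π (σ.symm (σ.symm.symm k)) (t.2.2 (σ.symm.symm k)) = t'.2.2 k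
    simp [h3]

theorem exists_tripleProfile_eq {D N : ℕ} (hN : 3 ≤ N) (d : Profile D) :
    ∃ t : HamVertex D N × HamVertex D N × HamVertex D N, tripleProfile t = d.1 := by
  let e : Fin D ≃ Σ i : Fin 5, Fin (d.1 i) :=
    Fintype.equivOfCardEq (by simp [Fintype.card_sigma, d.2])
  let u : Fin N := ⟨0, by omega⟩
  let v : Fin N := ⟨1, by omega⟩
  let w : Fin N := ⟨2, by omega⟩
  have huv : u ≠ v := by simp [u, v]
  have huw : u ≠ w := by simp [u, w]
  have hvw : v ≠ w := by simp [v, w]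
  -- Read by columns, these are the representatives `uuu`, `vuu`, `uvu`, `uuv`, `uvw` of the five
  -- states.
  refine ⟨(fun k => ![u, v, u, u, u] (e k).1, fun k => ![u, u, v, u, v] (e k).1,
    fun k => ![u, u, u, v, w] (e k).1), ?_⟩
  have hs : ∀ k, coordState (D := D) (N := N) (fun k => ![u, v, u, u, u] (e k).1,
      fun k => ![u, u, v, u, v] (e k).1, fun k => ![u, u, u, v, w] (e k).1) k = (e k).1 := by
    intro k
    simp only [coordState]
    generalize (e k).1 = i
    fin_cases i <;> simp [eqState, huv, hvw, huv.symm, huw.symm]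
  funext i
  rw [tripleProfile_eq_card]
  simp only [hs]
  rw [← Fintype.card_fin (d.1 i)]
  refine Fintype.card_congr ?_
  exact (e.subtypeEquiv (p := fun k => (e k).1 = i) (q := fun a => a.1 = i) fun _ => Iff.rfl).trans
    (Equiv.sigmaSubtype i)

end

/-! ### The fixed vectors of the automorphism group -/

noncomputable section

theorem repr_vtx3 {X : Type} [Fintype X] [DecidableEq X] (t u : X × X × X) :
    (cubeBasis X).repr (vtx3 t) u = if t = u then 1 else 0 := by
  rw [← cubeBasis_apply, Module.Basis.repr_self, Finsupp.single_apply]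

theorem repr_sum_vtx3 {X : Type} [Fintype X] [DecidableEq X] (f : X × X × X → ℂ) (u : X × X × X) :
    (cubeBasis X).repr (∑ t, f t • vtx3 t) u = f u := by
  simp [Finsupp.finsetSum_apply, repr_vtx3]

theorem sum_repr_vtx3 {X : Type} [Fintype X] [DecidableEq X] (v : StdCube X) :
    ∑ t, (cubeBasis X).repr v t • vtx3 t = v := by
  simp only [← cubeBasis_apply, Module.Basis.sum_repr]

theorem repr_profileVec {D N : ℕ} (g : (Fin 5 → ℕ) → ℂ)
    (t : HamVertex D N × HamVertex D N × HamVertex D N) :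
    (cubeBasis _).repr (profileVec D N g) t = g (tripleProfile t) := by
  rw [profileVec_apply]
  exact repr_sum_vtx3 (fun t => g (tripleProfile t)) t

theorem autMap3_vtx3 {X : Type} [Fintype X] [DecidableEq X] {Γ : SimpleGraph X} (g : Γ ≃g Γ)
    (t : X × X × X) : autMap3 g (vtx3 t) = vtx3 (g • t) := by
  have h : ∀ x : X, autMap g (vtx x) = vtx (g x) := fun x => by
    have : vtx x = (EuclideanSpace.basisFun X ℂ).toBasis x := by simp [vtx]
    rw [this, autMap, Module.Basis.constr_basis]
  simp only [autMap3, vtx3, TensorProduct.map_tmul, h]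
  rfl

theorem repr_autMap3 {X : Type} [Fintype X] [DecidableEq X] {Γ : SimpleGraph X} (g : Γ ≃g Γ)
    (v : StdCube X) (t : X × X × X) :
    (cubeBasis X).repr (autMap3 g v) (g • t) = (cubeBasis X).repr v t := by
  conv_lhs => rw [← sum_repr_vtx3 v]
  simp [autMap3_vtx3, Finsupp.finsetSum_apply, repr_vtx3]

theorem mem_autFix_iff {X : Type} [Fintype X] [DecidableEq X] {Γ : SimpleGraph X}
    {v : StdCube X} :
    v ∈ autFix Γ ↔ ∀ (g : Γ ≃g Γ) t, (cubeBasis X).repr v (g • t) = (cubeBasis X).repr v t := by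
  constructor
  · intro h g t
    conv_lhs => rw [← h g]
    rw [repr_autMap3]
  · intro h g
    refine (cubeBasis X).repr.injective (Finsupp.ext fun t => ?_)
    have := repr_autMap3 g v (g⁻¹ • t)
    rw [smul_inv_smul] at this
    rw [this, ← h g, smul_inv_smul]

/-! ### Stability of the fixed space under the generators -/

theorem sum_neighborFinset_iso {X M : Type*} [Fintype X] [DecidableEq X] [AddCommMonoid M]
    {Γ : SimpleGraph X} [DecidableRel Γ.Adj] (g : Γ ≃g Γ) (x : X) (f : X → M) :
    ∑ ξ ∈ Γ.neighborFinset (g x), f ξ = ∑ ξ ∈ Γ.neighborFinset x, f (g ξ) := by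
  symm
  refine Finset.sum_equiv g.toEquiv (fun ξ => ?_) fun _ _ => rfl
  simp only [SimpleGraph.mem_neighborFinset]
  exact g.map_adj_iff.symm

theorem dist_iso_le {X : Type*} {Γ : SimpleGraph X} (hΓ : Γ.Connected) (g : Γ ≃g Γ) (x y : X) :
    Γ.dist (g x) (g y) ≤ Γ.dist x y := by
  obtain ⟨p, hp⟩ := (hΓ x y).exists_walk_length_eq_dist
  rw [← hp]
  simpa using SimpleGraph.dist_le (p.map g.toHom)

theorem dist_iso {X : Type*} {Γ : SimpleGraph X} (hΓ : Γ.Connected) (g : Γ ≃g Γ) (x y : X) :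
    Γ.dist (g x) (g y) = Γ.dist x y :=
  (dist_iso_le hΓ g x y).antisymm (by simpa using dist_iso_le hΓ g.symm (g x) (g y))

theorem isStable_of_commute {X : Type} [Fintype X] [DecidableEq X] {Γ : SimpleGraph X}
    {T : Module.End ℂ (StdCube X)} (h : ∀ (g : Γ ≃g Γ) t, autMap3 g (T (vtx3 t)) = T (vtx3 (g • t))) :
    IsStable (autFix Γ) T := by
  intro v hv g
  have : autMap3 g * T = T * autMap3 g := cubeEnd_ext fun t => by
    rw [Module.End.mul_apply, Module.End.mul_apply, h, autMap3_vtx3]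
  have h1 := LinearMap.congr_fun this v
  rwa [Module.End.mul_apply, Module.End.mul_apply, hv g] at h1

theorem isStable_autFix_nodeMap {X : Type} [Fintype X] [DecidableEq X] (Γ : SimpleGraph X)
    [DecidableRel Γ.Adj] (r : Fin 3) : IsStable (autFix Γ) (nodeMap Γ r) := by
  refine isStable_of_commute fun g t => ?_
  rw [← cubeBasis_apply t, ← cubeBasis_apply (g • t)]
  fin_cases r <;> simp only [nodeMap, Module.Basis.constr_basis, map_sum, autMap3_vtx3]
  · exact (sum_neighborFinset_iso g t.1 fun ξ => vtx3 (ξ, g t.2.1, g t.2.2)).symm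
  · exact (sum_neighborFinset_iso g t.2.1 fun ξ => vtx3 (g t.1, ξ, g t.2.2)).symm
  · exact (sum_neighborFinset_iso g t.2.2 fun ξ => vtx3 (g t.1, g t.2.1, ξ)).symm

theorem isStable_autFix_edgeMap {X : Type} [Fintype X] [DecidableEq X] {Γ : SimpleGraph X}
    (hΓ : Γ.Connected) (θs : ℕ → ℂ) (r : Fin 3) : IsStable (autFix Γ) (edgeMap Γ θs r) := by
  refine isStable_of_commute fun g t => ?_
  rw [← cubeBasis_apply t, ← cubeBasis_apply (g • t)]
  fin_cases r <;> simp only [edgeMap, Module.Basis.constr_basis, map_smul, autMap3_vtx3]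
  · rw [← dist_iso hΓ g]; rfl
  · rw [← dist_iso hΓ g]; rfl
  · rw [← dist_iso hΓ g]; rfl

theorem hammingGraph_connected {D N : ℕ} (hN : N ≠ 0) : (hammingGraph D N).Connected :=
  have : NeZero N := ⟨hN⟩
  { preconnected := fun x y => (hammingGraph_exists_walk _ x y rfl).choose.reachable
    nonempty := ⟨fun _ => 0⟩ }

theorem oneCube_eq_profileVec (D N : ℕ) :
    oneCube (HamVertex D N) = profileVec D N fun _ => 1 := by
  rw [profileVec_apply, oneCube, Fintype.sum_prod_type, TensorProduct.sum_tmul]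
  refine Finset.sum_congr rfl fun x _ => ?_
  rw [Fintype.sum_prod_type, TensorProduct.sum_tmul, TensorProduct.tmul_sum]
  refine Finset.sum_congr rfl fun y _ => ?_
  rw [TensorProduct.tmul_sum, TensorProduct.tmul_sum]
  refine Finset.sum_congr rfl fun z _ => ?_
  rw [one_smul]
  rfl

theorem oneCube_mem_autFix (D N : ℕ) : oneCube (HamVertex D N) ∈ autFix (hammingGraph D N) := by
  rw [mem_autFix_iff, oneCube_eq_profileVec]
  intro g t
  rw [repr_profileVec, repr_profileVec]

theorem oneCube_ne_zero {D N : ℕ} (hN : N ≠ 0) : oneCube (HamVertex D N) ≠ 0 := by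
  have : NeZero N := ⟨hN⟩
  intro h
  have := repr_profileVec (fun _ => 1) ((fun _ => 0, fun _ => 0, fun _ => 0) :
    HamVertex D N × HamVertex D N × HamVertex D N)
  rw [← oneCube_eq_profileVec, h] at this
  simp at this

/-- A subspace that is stable under the generators and contains a nonzero vector whose coordinates
depend only on the profile contains all sums over the triples of a given profile. -/
theorem profileVec_single_mem {D N : ℕ} (hN : 3 ≤ N) {W : Submodule ℂ (StdCube (HamVertex D N))}
    (hA : ∀ r, IsStable W (nodeMap (hammingGraph D N) r))
    (hE : ∀ r, IsStable W (edgeMap (hammingGraph D N) (hamTheta D N) r))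
    {g : (Fin 5 → ℕ) → ℂ} (hg : profileVec D N g ∈ W) (h0 : profileVec D N g ≠ 0)
    (d : Profile D) : profileVec D N (Pi.single d.1 1) ∈ W := by
  have hN0 : (N : ℂ) ≠ 0 := by exact_mod_cast (by omega : N ≠ 0)
  -- Values of `g` off the compositions of `D` do not affect the vector; they are cut off to meet
  -- the support condition.
  let g' : (Fin 5 → ℕ) → ℂ := fun e => if ∑ l, e l = D then g e else 0
  have hgg' : profileVec D N g' = profileVec D N g :=
    profileVec_congr fun e he => by simp [g', he]
  refine single_mem_of_stable (g := g') (D := D) (W := W.comap (profileVec D N)) hN ?_ ?_ ?_ ?_ ?_ d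
  · intro s f hf
    have h1 := hE s _ hf
    rw [edgeMap_profileVec, map_sub, map_smul, map_smul] at h1
    have h2 := W.smul_mem (N : ℂ)⁻¹ (W.add_mem h1 (W.smul_mem (D : ℂ) hf))
    rwa [sub_add_cancel, smul_smul, inv_mul_cancel₀ hN0, one_smul] at h2
  · intro r f hf
    have h1 := hA r _ hf
    rw [nodeMap_profileVec, map_sub, map_smul] at h1
    have h2 := W.add_mem h1 (W.smul_mem (D : ℂ) hf)
    rwa [sub_add_cancel] at h2
  · rwa [Submodule.mem_comap, hgg']
  · intro h
    rw [← hgg', h, map_zero] at h0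
    exact h0 rfl
  · intro e he
    by_contra h
    exact he (if_neg h)

/-- The sum over one profile class is generated from `𝟏 ⊗ 𝟏 ⊗ 𝟏` inside the stable space `Fix(G)`,
so it is itself fixed, and an automorphism cannot leave the class. Preservation of distances alone
would not give this: three pair counts and the total `D` do not determine five counters. -/
theorem tripleProfile_smul {D N : ℕ} (hN : 3 ≤ N) (g : hammingGraph D N ≃g hammingGraph D N)
    (t : HamVertex D N × HamVertex D N × HamVertex D N) :
    tripleProfile (g • t) = tripleProfile t := by
  have hN0 : N ≠ 0 := by omega
  have h1 := oneCube_mem_autFix D N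
  have h2 := oneCube_ne_zero (D := D) hN0
  rw [oneCube_eq_profileVec] at h1 h2
  have h3 := profileVec_single_mem hN (isStable_autFix_nodeMap _)
    (isStable_autFix_edgeMap (hammingGraph_connected hN0) _) h1 h2
    ⟨tripleProfile t, sum_tripleProfile t⟩
  have h4 := mem_autFix_iff.mp h3 g t
  rw [repr_profileVec, repr_profileVec, Pi.single_eq_same] at h4
  by_contra h
  rw [Pi.single_eq_of_ne h] at h4
  exact zero_ne_one h4

theorem tripleOrbit_eq_iff {D N : ℕ} (hN : 3 ≤ N)
    {t t' : HamVertex D N × HamVertex D N × HamVertex D N} :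
    tripleOrbit (hammingGraph D N) t = tripleOrbit (hammingGraph D N) t'
      ↔ tripleProfile t = tripleProfile t' := by
  refine ⟨fun h => ?_, tripleOrbit_eq_of_profile⟩
  obtain ⟨g, hg⟩ : t ∈ MulAction.orbit (hammingGraph D N ≃g hammingGraph D N) t' :=
    Quotient.exact (s := MulAction.orbitRel _ _) h
  rw [← hg]
  exact tripleProfile_smul hN g t'

/-- The bijection from the orbits on triples to the profiles. -/
def orbitEquivProfile {D N : ℕ} (hN : 3 ≤ N) : TripleOrbit (hammingGraph D N) ≃ Profile D :=
  Equiv.ofBijective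
    (Quotient.lift (s := MulAction.orbitRel _ _)
      (fun t => (⟨tripleProfile t, sum_tripleProfile t⟩ : Profile D))
      fun _ _ h => Subtype.ext ((tripleOrbit_eq_iff hN).mp
        (Quotient.sound (s := MulAction.orbitRel _ _) h))) (by
    constructor
    · intro a b
      refine Quotient.inductionOn₂ (s₁ := MulAction.orbitRel _ _) (s₂ := MulAction.orbitRel _ _)
        a b fun t t' h => ?_
      exact (tripleOrbit_eq_iff hN).mpr (congrArg Subtype.val h)
    · intro d
      obtain ⟨t, ht⟩ := exists_tripleProfile_eq hN d
      exact ⟨tripleOrbit _ t, Subtype.ext ht⟩)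

theorem orbitEquivProfile_apply {D N : ℕ} (hN : 3 ≤ N)
    (t : HamVertex D N × HamVertex D N × HamVertex D N) :
    (orbitEquivProfile hN (tripleOrbit (hammingGraph D N) t)).1 = tripleProfile t := rfl

theorem orbitVec_symm {D N : ℕ} (hN : 3 ≤ N) (d : Profile D) :
    orbitVec ((orbitEquivProfile (N := N) hN).symm d) = profileVec D N (Pi.single d.1 1) := by
  classical
  rw [orbitVec, profileVec_apply, Finset.sum_filter]
  refine Finset.sum_congr rfl fun t _ => ?_
  simp only [Equiv.eq_symm_apply, Subtype.ext_iff, orbitEquivProfile_apply, Pi.single_apply,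
    ite_smul, one_smul, zero_smul]

/-- Coefficients of a fixed vector are constant on orbits, and triples of equal profile share an
orbit. Profiles that do not occur receive the value 0. -/
theorem exists_profileVec_eq {D N : ℕ} {v : StdCube (HamVertex D N)}
    (hv : v ∈ autFix (hammingGraph D N)) : ∃ g, profileVec D N g = v := by
  classical
  refine ⟨fun e => if h : ∃ t, tripleProfile t = e then (cubeBasis _).repr v h.choose else 0, ?_⟩
  conv_rhs => rw [← sum_repr_vtx3 v]
  rw [profileVec_apply]
  refine Finset.sum_congr rfl fun t _ => ?_
  have h : ∃ u : HamVertex D N × HamVertex D N × HamVertex D N,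
    tripleProfile u = tripleProfile t := ⟨t, rfl⟩
  rw [dif_pos h]
  obtain ⟨g, hg⟩ : h.choose ∈ MulAction.orbit (hammingGraph D N ≃g hammingGraph D N) t :=
    Quotient.exact (s := MulAction.orbitRel _ _) (tripleOrbit_eq_of_profile h.choose_spec)
  rw [← hg]
  congr 1
  exact mem_autFix_iff.mp hv g t

theorem profileVec_mem_of_single {D N : ℕ} {W : Submodule ℂ (StdCube (HamVertex D N))}
    (h : ∀ d : Profile D, profileVec D N (Pi.single d.1 1) ∈ W) (g : (Fin 5 → ℕ) → ℂ) :
    profileVec D N g ∈ W := by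
  classical
  -- Restricting to the profiles that occur makes the expansion into indicators finite.
  have h1 : profileVec D N g = ∑ e ∈ Finset.univ.image (tripleProfile (D := D) (N := N)),
      g e • profileVec D N (Pi.single e 1) := by
    refine (cubeBasis _).repr.injective (Finsupp.ext fun t => ?_)
    simp only [map_sum, map_smul, Finsupp.finsetSum_apply, Finsupp.smul_apply, repr_profileVec,
      Pi.single_apply]
    simp
  rw [h1]
  refine W.sum_mem fun e he => W.smul_mem _ ?_
  obtain ⟨t, -, rfl⟩ := Finset.mem_image.mp he
  exact h ⟨tripleProfile t, sum_tripleProfile t⟩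

theorem autFix_le_of_single {D N : ℕ} {W : Submodule ℂ (StdCube (HamVertex D N))}
    (h : ∀ d : Profile D, profileVec D N (Pi.single d.1 1) ∈ W) :
    autFix (hammingGraph D N) ≤ W := by
  intro v hv
  obtain ⟨g, rfl⟩ := exists_profileVec_eq hv
  exact profileVec_mem_of_single h g

theorem profileVec_mem_autFix {D N : ℕ} (hN : 3 ≤ N) (g : (Fin 5 → ℕ) → ℂ) :
    profileVec D N g ∈ autFix (hammingGraph D N) := by
  rw [mem_autFix_iff]
  intro a t
  rw [repr_profileVec, repr_profileVec, tripleProfile_smul hN]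

/-! ### Orthogonality and linear independence of the orbit sums -/

theorem inner_vtx3 {X : Type} [Fintype X] [DecidableEq X] (t u : X × X × X) :
    inner ℂ (vtx3 t) (vtx3 u) = if t = u then 1 else 0 := by
  obtain ⟨x, y, z⟩ := t
  obtain ⟨x', y', z'⟩ := u
  simp only [vtx3, TensorProduct.inner_tmul, vtx, EuclideanSpace.inner_single_left, Prod.mk.injEq]
  simp only [PiLp.single_apply, map_one, mul_ite, mul_one, mul_zero]
  split_ifs <;> simp_all

theorem orthonormal_vtx3 {X : Type} [Fintype X] [DecidableEq X] :
    Orthonormal ℂ (vtx3 (X := X)) := orthonormal_iff_ite.mpr inner_vtx3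

theorem inner_sum_vtx3 {X : Type} [Fintype X] [DecidableEq X] (a b : X × X × X → ℂ) :
    inner ℂ (∑ t, a t • vtx3 t) (∑ t, b t • vtx3 t) = ∑ t, (starRingEnd ℂ) (a t) * b t :=
  orthonormal_vtx3.inner_sum a b Finset.univ

theorem inner_profileVec_single {D N : ℕ} {d d' : Fin 5 → ℕ} (h : d ≠ d') :
    inner ℂ (profileVec D N (Pi.single d 1)) (profileVec D N (Pi.single d' 1)) = 0 := by
  rw [profileVec_apply, profileVec_apply, inner_sum_vtx3]
  refine Finset.sum_eq_zero fun t _ => ?_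
  by_cases ht : tripleProfile t = d
  · rw [Pi.single_eq_of_ne (i := d') (by rw [ht]; exact h), mul_zero]
  · rw [Pi.single_eq_of_ne ht, map_zero, zero_mul]

theorem linearIndependent_profileVec_single {D N : ℕ} (hN : 3 ≤ N) :
    LinearIndependent ℂ fun d : Profile D => profileVec D N (Pi.single d.1 1) := by
  rw [linearIndependent_iff']
  intro s c h d hd
  obtain ⟨t, ht⟩ := exists_tripleProfile_eq hN d
  have h1 : (cubeBasis (HamVertex D N)).repr
      (∑ d ∈ s, c d • profileVec D N (Pi.single d.1 1)) t = c d := by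
    simp only [map_sum, map_smul, Finsupp.finsetSum_apply, Finsupp.smul_apply, repr_profileVec, ht]
    rw [Finset.sum_eq_single d]
    · simp
    · intro e _ hed
      rw [Pi.single_eq_of_ne fun h => hed (Subtype.ext h.symm), smul_zero]
    · exact fun h => absurd hd h
  rw [← h1, h]
  simp

end

/-! ### The fundamental submodule -/

noncomputable section

theorem hamAction_mem_of_stable {D N : ℕ} {W : Submodule ℂ (StdCube (HamVertex D N))}
    (hA : ∀ r, IsStable W (nodeMap (hammingGraph D N) r))
    (hE : ∀ r, IsStable W (edgeMap (hammingGraph D N) (hamTheta D N) r)) (a : HamT N) :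
    IsStable W (hamAction D N a) := by
  obtain ⟨x, rfl⟩ := RingQuot.mkAlgHom_surjective ℂ _ a
  induction x using FreeAlgebra.induction with
  | grade0 c =>
    intro v hv
    rw [AlgHom.commutes, AlgHom.commutes, Module.algebraMap_end_apply]
    exact W.smul_mem c hv
  | grade1 i =>
    rcases i with i | i
    · rw [hamAction_A]
      exact hA i
    · rw [hamAction_As]
      exact hE i
  | mul x y hx hy =>
    intro v hv
    rw [map_mul, map_mul, Module.End.mul_apply]
    exact hx _ (hy v hv)
  | add x y hx hy =>
    rw [map_add, map_add]
    exact hx.add hy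

/-- The fixed vectors of the automorphism group, as a submodule for the algebra. -/
def fixSubmodule {D N : ℕ} (hN : N ≠ 0) : Submodule (HamT N) (StdCube (HamVertex D N)) where
  carrier := autFix (hammingGraph D N)
  add_mem' := (autFix (hammingGraph D N)).add_mem
  zero_mem' := (autFix (hammingGraph D N)).zero_mem
  smul_mem' a v hv := hamAction_mem_of_stable (isStable_autFix_nodeMap _)
    (isStable_autFix_edgeMap (hammingGraph_connected hN) _) a v hv

theorem restrictScalars_fixSubmodule {D N : ℕ} (hN : N ≠ 0) :
    (fixSubmodule (D := D) hN).restrictScalars ℂ = autFix (hammingGraph D N) := rfl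

theorem isStable_nodeMap {D N : ℕ} (Λ : Submodule (HamT N) (StdCube (HamVertex D N))) (r : Fin 3) :
    IsStable (Λ.restrictScalars ℂ) (nodeMap (hammingGraph D N) r) := fun v hv => by
  rw [← hamAction_A, ← hamT_smul_def]
  exact Λ.smul_mem _ hv

theorem isStable_edgeMap {D N : ℕ} (Λ : Submodule (HamT N) (StdCube (HamVertex D N))) (r : Fin 3) :
    IsStable (Λ.restrictScalars ℂ) (edgeMap (hammingGraph D N) (hamTheta D N) r) := fun v hv => by
  rw [← hamAction_As, ← hamT_smul_def]
  exact Λ.smul_mem _ hv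

/-- A nonzero vector of a submodule of `Fix(G)` is a profile vector, hence generates every orbit
sum, and these span `Fix(G)`. -/
theorem fixSubmodule_isAtom {D N : ℕ} (hN : 3 ≤ N) (hN0 : N ≠ 0) :
    IsAtom (fixSubmodule (D := D) hN0) := by
  constructor
  · intro h
    have h1 : oneCube (HamVertex D N) ∈ fixSubmodule (D := D) hN0 := oneCube_mem_autFix D N
    rw [h] at h1
    exact oneCube_ne_zero hN0 ((Submodule.mem_bot _).mp h1)
  · intro Λ hΛ
    by_contra h
    obtain ⟨v, hv, h0⟩ := Submodule.exists_mem_ne_zero_of_ne_bot h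
    obtain ⟨g, rfl⟩ := exists_profileVec_eq (hΛ.le hv)
    exact hΛ.not_ge (autFix_le_of_single (W := Λ.restrictScalars ℂ) fun d =>
      profileVec_single_mem hN (isStable_nodeMap Λ) (isStable_edgeMap Λ) hv h0 d)

theorem fixSubmodule_isFundamental {D N : ℕ} (hN : 3 ≤ N) (hN0 : N ≠ 0) :
    IsFundamental (fixSubmodule (D := D) hN0) :=
  ⟨isSimpleModule_iff_isAtom.mpr (fixSubmodule_isAtom hN hN0), oneCube_mem_autFix D N⟩

/-- Two distinct irreducible submodules intersect in zero, whereas both contain the nonzero vector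
`𝟏 ⊗ 𝟏 ⊗ 𝟏`. -/
theorem IsFundamental.eq_fixSubmodule {D N : ℕ} (hN : 3 ≤ N) (hN0 : N ≠ 0)
    {Λ : Submodule (HamT N) (StdCube (HamVertex D N))} (hΛ : IsFundamental Λ) :
    Λ = fixSubmodule hN0 := by
  have h1 := isSimpleModule_iff_isAtom.mp hΛ.1
  have h2 := fixSubmodule_isAtom (D := D) hN hN0
  by_contra h
  have h3 := (h1.disjoint_of_ne h2 h).le_bot
    (show oneCube (HamVertex D N) ∈ Λ ⊓ fixSubmodule hN0 from ⟨hΛ.2, oneCube_mem_autFix D N⟩)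
  exact oneCube_ne_zero hN0 ((Submodule.mem_bot _).mp h3)

/-- The sum over the orbit of a given profile, as a fixed vector. -/
def fixVec {N : ℕ} (hN : 3 ≤ N) {D : ℕ} (d : Profile D) : autFix (hammingGraph D N) :=
  ⟨profileVec D N (Pi.single d.1 1), profileVec_mem_autFix hN _⟩

theorem linearIndependent_fixVec (D : ℕ) {N : ℕ} (hN : 3 ≤ N) :
    LinearIndependent ℂ (fixVec (D := D) hN) :=
  LinearIndependent.of_comp (autFix (hammingGraph D N)).subtype
    (linearIndependent_profileVec_single hN)

theorem span_fixVec (D : ℕ) {N : ℕ} (hN : 3 ≤ N) :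
    ⊤ ≤ Submodule.span ℂ (Set.range (fixVec (D := D) hN)) := by
  intro v _
  obtain ⟨w, hw, hwv⟩ := autFix_le_of_single (N := N)
    (W := (Submodule.span ℂ (Set.range (fixVec (D := D) hN))).map
      (autFix (hammingGraph D N)).subtype)
    (fun d => ⟨fixVec hN d, Submodule.subset_span ⟨d, rfl⟩, rfl⟩) v.2
  rwa [← Subtype.ext hwv]

/-- The basis of the fixed space formed by the sums over the orbits. -/
def fixBasis (D : ℕ) {N : ℕ} (hN : 3 ≤ N) :
    Module.Basis (Profile D) ℂ (autFix (hammingGraph D N)) :=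
  Module.Basis.mk (linearIndependent_fixVec D hN) (span_fixVec D hN)

theorem coe_fixBasis {D N : ℕ} (hN : 3 ≤ N) (d : Profile D) :
    (fixBasis D hN d : StdCube (HamVertex D N)) = profileVec D N (Pi.single d.1 1) := by
  rw [fixBasis, Module.Basis.mk_apply, fixVec]

/-- Stars and bars: a profile is a multiset of `D` states chosen from five. -/
theorem card_profile (D : ℕ) : Nat.card (Profile D) = (D + 4).choose 4 := by
  rw [← Nat.card_congr (Sym.equivNatSumOfFintype (Fin 5) D), Nat.card_eq_fintype_card,
    Sym.card_sym_eq_choose, Fintype.card_fin, ← Nat.choose_symm_add]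
  congr 1
  omega

end

theorem proposition11 (D N : ℕ) (hD : 1 ≤ D) (hN : 3 ≤ N) :
    (∃! Λ : Submodule (HamT N) (StdCube (HamVertex D N)), IsFundamental Λ) ∧
    ∀ Λ : Submodule (HamT N) (StdCube (HamVertex D N)), IsFundamental Λ →
      Λ.restrictScalars ℂ = autFix (hammingGraph D N) ∧
      (∃ F : TripleOrbit (hammingGraph D N) ≃ Profile D,
        (∀ t : HamVertex D N × HamVertex D N × HamVertex D N,
          (F (tripleOrbit (hammingGraph D N) t)).1 = tripleProfile t) ∧
        ∃ b : Module.Basis (Profile D) ℂ (Λ.restrictScalars ℂ),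
          (∀ d : Profile D, (b d : StdCube (HamVertex D N)) = orbitVec (F.symm d)) ∧
          Pairwise fun d d' : Profile D =>
            inner ℂ (b d : StdCube (HamVertex D N)) (b d' : StdCube (HamVertex D N)) = 0) ∧
      Module.finrank ℂ (Λ.restrictScalars ℂ) = (D + 4).choose 4 := by
  have hN0 : N ≠ 0 := by omega
  refine ⟨⟨fixSubmodule hN0, fixSubmodule_isFundamental hN hN0,
    fun Λ hΛ => hΛ.eq_fixSubmodule hN hN0⟩, fun Λ hΛ => ?_⟩
  obtain rfl := hΛ.eq_fixSubmodule hN hN0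
  refine ⟨restrictScalars_fixSubmodule hN0, ⟨orbitEquivProfile hN, orbitEquivProfile_apply hN,
    fixBasis D hN, fun d => ?_, fun d d' h => ?_⟩, ?_⟩
  · rw [orbitVec_symm]
    exact coe_fixBasis hN d
  · change inner ℂ (fixBasis D hN d : StdCube (HamVertex D N))
      (fixBasis D hN d' : StdCube (HamVertex D N)) = 0
    rw [coe_fixBasis, coe_fixBasis]
    exact inner_profileVec_single fun e => h (Subtype.ext e)
  · rw [← card_profile]
    exact Module.finrank_eq_nat_card_basis (fixBasis D hN)
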